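/- **Model.** Let $V$ be a set of $n$ potential nodes. A dynamic graph is a sequence of graphs $G_0=(V_0,E_0),G_1=(V_1,E_1),\dots$ with $\emptyset=V_0\subseteq V_1\subseteq\dots\subseteq V$, where $V_r$ is the set of nodes that are awake in round $r$. In every round $r$, first an adversary provides $G_r$; then every awake node draws fresh randomness, broadcasts one message (of unrestricted size) to its neighbors in $G_r$, receives the messages of its neighbors in $G_r$, and updates its state; finally it returns an output. All nodes run the same algorithm, which knows $n$ but not the round number. The adversary is adaptive without any obliviousness: $G_r$ may depend on all random choices of all nodes in the rounds $0,\dots,r$, including those of round $r$ itself. For an integer $T\ge 1$ and a round $r$ let $r_0=\max\{0,r-T+1\}$ and $$V_r^{T\cap}=\bigcap_{r'=r_0}^{r}V_{r'},\qquad E_r^{T\cap}=\bigcap_{r'=r_0}^{r}E_{r'},\qquad E_r^{T\cup}=\bigcup_{r'=r_0}^{r}E_{r'}.$$ The $T$-intersection graph in round $r$ is $(V_r^{T\cap},E_r^{T\cap})$ and the $T$-union graph in round $r$ is $(V_r^{T\cap},E_r^{T\cup})$; the degree $d_r^{T\cup}(v)$ of $v$ in the latter is the number of nodes $u$ with $\{u,v\}\in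 E_r^{T\cup}$. An output in round $r$ is a $T$-dynamic solution for (degree+1)-coloring if every $v\in V_r^{T\cap}$ outputs a color in $\{1,\dots,d_r^{T\cup}(v)+1\}$ and any two nodes adjacent in the $T$-intersection graph output different colors. The $2$-neighborhood of $v$ is static on $[r,r_2]$ if the subgraphs of $G_l$ induced by the nodes at distance at most $2$ from $v$ in $G_l$ are the same for all $l\in[r,r_2]$. **Corollary.** For all constants $c$ and $k$ there are $T=T(n)\geq 1$ with $T=O(\log n)$ and a randomized distributed algorithm such that for every $n$ and every such adversary, with probability at least $1-1/n^c$, the following holds in the execution of length $n^k$ (the rounds $0,\dots,n^k-1$): 1. In every round the output is a $T$-dynamic solution for (degree+1)-coloring. 2. For all rounds $r\le r_2$ and every node $v\in V_r$ whose $2$-neighborhood is static on $[r,r_2]$, the output of $v$ is the same in all rounds of $[r+2T,r_2]$. -/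

import Mathlib

open MeasureTheory ProbabilityTheory

noncomputable section

/-- A dynamic graph over a set `V` of potential nodes: in round `r`, `awake r` is the set of nodes
that have joined the network so far and `graph r` holds the current edges.  No node is awake in
round `0`, the sets of awake nodes are increasing, and edges join awake nodes. -/
structure DynGraph (V : Type) where
  awake : ℕ → Set V
  graph : ℕ → SimpleGraph V
  awake_zero : awake 0 = ∅
  awake_mono : Monotone awake
  awake_of_adj : ∀ r u v, (graph r).Adj u v → u ∈ awake r

namespace DynGraph

variable {V : Type} (G : DynGraph V)

/-- The rounds `max 0 (r - T + 1), …, r` of the sliding window of length `T` ending in round `r`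
(the subtraction is truncated at `0`). -/
def window (T r : ℕ) : Set ℕ := Set.Icc (r + 1 - T) r

/-- The nodes that are awake throughout the window: the common vertex set of the
`T`-intersection graph and of the `T`-union graph in round `r`. -/
def windowNodes (T r : ℕ) : Set V := {v | ∀ s ∈ window T r, v ∈ G.awake s}

/-- The edges of the `T`-intersection graph in round `r`: those present in all rounds of the
window. -/
def interGraph (T r : ℕ) : SimpleGraph V where
  Adj u v := u ≠ v ∧ ∀ s ∈ window T r, (G.graph s).Adj u v
  symm := ⟨fun _ _ h => ⟨h.1.symm, fun s hs => (h.2 s hs).symm⟩⟩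
  loopless := ⟨fun _ h => h.1 rfl⟩

/-- The edges of the `T`-union graph in round `r`: those present in some round of the window. -/
def unionGraph (T r : ℕ) : SimpleGraph V where
  Adj u v := ∃ s ∈ window T r, (G.graph s).Adj u v
  symm := ⟨fun _ _ ⟨s, hs, h⟩ => ⟨s, hs, h.symm⟩⟩
  loopless := ⟨fun _ ⟨_, _, h⟩ => h.ne rfl⟩

/-- The nodes at distance at most `α` from `v` in round `r`. -/
def neighborhood (r α : ℕ) (v : V) : Set V := {u | (G.graph r).edist v u ≤ α}

/-- The `α`-neighborhood of `v` is static in all rounds of `[r, r₂]`: the subgraphs of the current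
graph induced by the `α`-neighborhood of `v` are the same (same vertices, same edges) in all these
rounds. -/
def IsStatic (α : ℕ) (v : V) (r r₂ : ℕ) : Prop :=
  ∀ l ∈ Set.Icc r r₂, ∀ l' ∈ Set.Icc r r₂,
    G.neighborhood l α v = G.neighborhood l' α v ∧
      ∀ u ∈ G.neighborhood l α v, ∀ w ∈ G.neighborhood l α v,
        ((G.graph l).Adj u w ↔ (G.graph l').Adj u w)

end DynGraph

/-- `y` is a proper coloring (no bound on the number of colors) of the graph with vertex set `S`
and edges `H`; `none` means that there is no output yet. -/
def IsProperColoring {V : Type} (S : Set V) (H : SimpleGraph V) (y : V → Option ℕ) : Prop :=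
  (∀ v ∈ S, y v ≠ none) ∧ ∀ u ∈ S, ∀ v ∈ S, H.Adj u v → y u ≠ y v

/-- Every node `v ∈ S` has a color in `{1, …, deg v + 1}`, with the degree taken in `H`. -/
def IsDegreeColoring {V : Type} (S : Set V) (H : SimpleGraph V) (y : V → Option ℕ) : Prop :=
  ∀ v ∈ S, ∃ c, y v = some c ∧ 1 ≤ c ∧ c ≤ (H.neighborSet v).ncard + 1

/-- `y` is a `T`-dynamic solution of (degree+1)-coloring in round `r`: the packing part (proper
coloring) holds in the intersection graph, the covering part (color range) in the union graph. -/
def DynGraph.IsDynamicSolution {V : Type} (G : DynGraph V) (T r : ℕ) (y : V → Option ℕ) : Prop :=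
  IsProperColoring (G.windowNodes T r) (G.interGraph T r) y ∧
    IsDegreeColoring (G.windowNodes T r) (G.unionGraph T r) y

/-- A randomized distributed algorithm in the synchronous local broadcast model.  All nodes run
the same program, have no identifiers and do not know the round number.  In each round a node
draws a fresh uniformly random element of the finite set `Coin`, broadcasts one message to its
current neighbors, receives the multiset of the messages of its current neighbors, changes its
state, and returns an output. -/
structure DistAlgorithm where
  State : Type
  Msg : Type
  Coin : Type
  fintypeCoin : Fintype Coin
  nonemptyCoin : Nonempty Coin
  init : State
  send : State → Coin → Msg
  update : State → Coin → Multiset Msg → State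
  output : State → Option ℕ

namespace DistAlgorithm

instance (A : DistAlgorithm) : Fintype A.Coin := A.fintypeCoin

instance (A : DistAlgorithm) : Nonempty A.Coin := A.nonemptyCoin

instance (A : DistAlgorithm) : MeasurableSpace A.Coin := ⊤

/-- All random choices of an execution: `ω r v` is the one of node `v` in round `r`. -/
abbrev Tape (A : DistAlgorithm) (V : Type) : Type := ℕ → V → A.Coin

/-- The law of the random choices: independent over rounds and nodes, and uniform. -/
def tapeMeasure (A : DistAlgorithm) (V : Type) [Fintype V] : Measure (A.Tape V) :=
  Measure.infinitePi fun _ : ℕ => Measure.pi fun _ : V => (PMF.uniformOfFintype A.Coin).toMeasure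

open Classical in
/-- The state of each node at the beginning of round `r`, in the execution on the dynamic graph `G`
with random choices `ω`.  A node that is not awake stays in its initial state. -/
def stateAt (A : DistAlgorithm) {V : Type} [Fintype V] (G : DynGraph V) (ω : A.Tape V) :
    ℕ → V → A.State
  | 0 => fun _ => A.init
  | r + 1 => fun v =>
      if v ∈ G.awake r then
        A.update (A.stateAt G ω r v) (ω r v)
          (((Finset.univ : Finset V).filter fun u => (G.graph r).Adj v u).val.map
            fun u => A.send (A.stateAt G ω r u) (ω r u))
      else A.stateAt G ω r v

/-- The output of each node at the end of round `r`. -/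
def outputAt (A : DistAlgorithm) {V : Type} [Fintype V] (G : DynGraph V) (ω : A.Tape V)
    (r : ℕ) (v : V) : Option ℕ :=
  A.output (A.stateAt G ω (r + 1) v)

end DistAlgorithm

/-- An adaptive adversary without any obliviousness: the graph that it provides in round `r` may
depend on all random choices of all nodes in the rounds `0, …, r`, including those of round `r`
itself (and so on all states, messages and outputs up to then). -/
structure Adversary (A : DistAlgorithm) (V : Type) where
  play : A.Tape V → DynGraph V
  adapted : ∀ (r : ℕ) (ω ω' : A.Tape V), (∀ s ≤ r, ω s = ω' s) →
    (play ω).awake r = (play ω').awake r ∧ (play ω).graph r = (play ω').graph r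

/-- The guarantees for the first `L` rounds (rounds `0, …, L - 1`) of an execution: the output is a
`T`-dynamic solution in every round, and the output of a node `v` does not change during
`[r + 2T, r₂]` if `v` is awake in round `r` and its `2`-neighborhood is static during `[r, r₂]`. -/
def Guarantees (A : DistAlgorithm) {V : Type} [Fintype V] (T L : ℕ) (G : DynGraph V)
    (ω : A.Tape V) : Prop :=
  (∀ r < L, G.IsDynamicSolution T r (A.outputAt G ω r)) ∧
    ∀ r r₂ : ℕ, r₂ < L → ∀ v ∈ G.awake r, G.IsStatic 2 v r r₂ →
      ∀ l ∈ Set.Icc (r + 2 * T) r₂, ∀ l' ∈ Set.Icc (r + 2 * T) r₂,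
        A.outputAt G ω l v = A.outputAt G ω l' v

end

/-!
The algorithm runs a *base coloring* forever and, in each round, starts an *extension* of the
current base coloring that is output a fixed number `j = O(log n)` of rounds later; thus `T = j + 1`
and the window of a round is exactly the lifetime of the extension that is output in it.

* The base coloring is partial.  At the end of every round it is proper on the current graph and
  uses only colors up to the current degree plus one, because a node gives up its color as soon as
  a rule is violated.  While the `1`-neighborhood of a node is static the node keeps its color
  (`base_proper`, `base_keep`).
* An extension never gives up a color, and it respects only those edges that have been present in
  every round since its start, so it is proper on the intersection graph (`ext_proper`) and its
  colors are limited by the degree at its start, hence by the degree in the union graph.  Nodes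
  recognize persistent edges by random identifiers, which are distinct with high probability.
* Where the surroundings are static, the base coloring is complete after `j` rounds and constant
  from then on; an extension keeps the colors that it starts with, so that the output is constant
  after `j` more rounds (`guarantees_of_complete`).

It remains to see that uncolored nodes get a color within `j` rounds.  An uncolored node is active
with probability `1/4` and then proposes a random color of its palette, computed from the messages
of the previous round: the palette lacks the colors that neighbors held or proposed then, so a
color acquired by a neighbor in that round is never proposed.  By Markov's inequality at most half
of the uncolored neighbors propose in a given round, with probability at least `1/2`; in this case
the palette is so large that the next proposal succeeds with probability at least `1/8`, for any
past.  The adversary sees the coins but can only remove competitors, as the set of respected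
neighbors never grows, so it does not help it that the edges of a round depend on the coins
(`FailsTwice.crowded_or_collision`).  Hence two rounds without success have conditional probability
at most `15/16` (`measureReal_failsTwice_le`), both for extensions and for base colors in static
surroundings, and a union bound finishes the proof.
-/

noncomputable section

/-! ### Events of a round given the past -/

section FreshRound

variable {Y : Type} [Finite Y] [MeasurableSpace Y] [DiscreteMeasurableSpace Y]

lemma measurableSet_of_dependsOn {t : ℕ} {H : Set (ℕ → Y)}
    (hH : DependsOn (fun ω => ω ∈ H) (Set.Iio t)) : MeasurableSet H := by
  have h : H = (Finset.range t).restrict ⁻¹' ((Finset.range t).restrict '' H) := by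
    refine Set.Subset.antisymm (Set.subset_preimage_image _ _) ?_
    rintro ω ⟨ω', hω', he⟩
    refine (iff_of_eq (hH fun i hi => ?_)).1 hω'
    exact congrFun he ⟨i, Finset.mem_range.2 hi⟩
  rw [h]
  exact Finset.measurable_restrict _ (MeasurableSet.of_discrete)

/-- The coins of round `t` are independent of the past: an event about them that is chosen depending
on the coins of the earlier rounds, and that has probability at most `q` for every such choice, keeps
this bound conditionally on any event `H` of the past. -/
lemma measureReal_fresh_le (μ : Measure Y) [IsProbabilityMeasure μ] {t : ℕ} {H : Set (ℕ → Y)}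
    (hH : DependsOn (fun ω => ω ∈ H) (Set.Iio t)) {B : (ℕ → Y) → Set Y}
    (hB : DependsOn B (Set.Iio t)) {q : ℝ} (hq : ∀ ω ∈ H, μ.real (B ω) ≤ q) :
    (Measure.infinitePi fun _ : ℕ => μ).real {ω | ω ∈ H ∧ ω t ∈ B ω} ≤
      q * (Measure.infinitePi fun _ : ℕ => μ).real H := by
  classical
  have := Fintype.ofFinite Y
  set P := Measure.infinitePi fun _ : ℕ => μ
  let ρ : (ℕ → Y) → (Finset.range t → Y) := (Finset.range t).restrict
  have hρ : Measurable ρ := Finset.measurable_restrict _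
  -- `H` is the disjoint union of the cylinders over the histories in `I`
  let I : Finset (Finset.range t → Y) := Finset.univ.filter fun h => ∃ ω ∈ H, ρ ω = h
  have hHI : H = ⋃ h ∈ I, ρ ⁻¹' {h} := by
    ext ω
    simp only [I, Set.mem_iUnion, Finset.mem_filter, Finset.mem_univ, true_and, Set.mem_preimage,
      Set.mem_singleton_iff, exists_prop, exists_eq_right']
    refine ⟨fun h => ⟨ω, h, rfl⟩, ?_⟩
    rintro ⟨ω', hω', he⟩
    refine (iff_of_eq (hH fun i hi => ?_)).1 hω'
    exact congrFun he ⟨i, Finset.mem_range.2 hi⟩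
  have hPH : P.real H = ∑ h ∈ I, P.real (ρ ⁻¹' {h}) := by
    conv_lhs => rw [hHI]
    refine measureReal_biUnion_finset ?_ fun h _ => hρ (MeasurableSet.of_discrete)
    intro a _ b _ hab
    exact Disjoint.preimage _ (Set.disjoint_singleton.2 hab)
  have hcyl : ∀ ω ∈ H, P.real (ρ ⁻¹' {ρ ω} ∩ {x | x t ∈ B ω}) =
      P.real (ρ ⁻¹' {ρ ω}) * μ.real (B ω) := by
    intro ω _
    have e1 : ρ ⁻¹' {ρ ω} = ((Finset.range t : Finset ℕ) : Set ℕ).pi fun i => {ω i} := by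
      ext x
      simp only [ρ, Set.mem_preimage, Set.mem_singleton_iff, Set.mem_pi, Finset.mem_coe]
      exact ⟨fun h i hi => congrFun h ⟨i, hi⟩, fun h => funext fun i => h i i.2⟩
    have e2 : ρ ⁻¹' {ρ ω} ∩ {x | x t ∈ B ω} = ((Finset.range (t + 1) : Finset ℕ) : Set ℕ).pi
        fun i => if i < t then {ω i} else B ω := by
      rw [e1]
      ext x
      simp only [Set.mem_inter_iff, Set.mem_pi, Finset.mem_coe, Finset.mem_range,
        Set.mem_ofPred_eq]
      constructor
      · rintro ⟨h1, h2⟩ i hi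
        rcases (Nat.lt_succ_iff_lt_or_eq.1 hi) with h | rfl
        · simpa [h] using h1 i h
        · simpa using h2
      · intro h
        exact ⟨fun i hi => by simpa [hi] using h i (by omega), by simpa using h t (by omega)⟩
    rw [e2, e1, measureReal_def, measureReal_def, measureReal_def,
      Measure.infinitePi_pi _ (fun _ _ => MeasurableSet.of_discrete),
      Measure.infinitePi_pi _ (fun _ _ => MeasurableSet.of_discrete), Finset.prod_range_succ,
      ENNReal.toReal_mul]
    congr 2
    · exact Finset.prod_congr rfl fun i hi => by simp [Finset.mem_range.1 hi]
    · simp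
  have hsub : {ω | ω ∈ H ∧ ω t ∈ B ω} ⊆ ⋃ h ∈ I, {ω | ρ ω = h ∧ ω t ∈ B ω} := by
    rintro ω ⟨h1, h2⟩
    simp only [Set.mem_iUnion, I]
    exact ⟨ρ ω, by simpa using ⟨ω, h1, rfl⟩, rfl, h2⟩
  calc P.real {ω | ω ∈ H ∧ ω t ∈ B ω} ≤ P.real (⋃ h ∈ I, {ω | ρ ω = h ∧ ω t ∈ B ω}) :=
        measureReal_mono hsub (measure_ne_top _ _)
    _ ≤ ∑ h ∈ I, P.real {ω | ρ ω = h ∧ ω t ∈ B ω} := measureReal_biUnion_finset_le _ _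
    _ ≤ ∑ h ∈ I, q * P.real (ρ ⁻¹' {h}) := by
        refine Finset.sum_le_sum fun h hh => ?_
        obtain ⟨ω, hω, rfl⟩ : ∃ ω ∈ H, ρ ω = h := by simpa [I] using hh
        have hle : {x | ρ x = ρ ω ∧ x t ∈ B x} ⊆ ρ ⁻¹' {ρ ω} ∩ {x | x t ∈ B ω} := by
          rintro x ⟨h1, h2⟩
          refine ⟨h1, ?_⟩
          have : B x = B ω := hB fun i hi => congrFun h1 ⟨i, Finset.mem_range.2 hi⟩
          simpa [← this] using h2
        refine (measureReal_mono hle).trans ?_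
        rw [hcyl ω hω, mul_comm]
        exact mul_le_mul_of_nonneg_right (hq ω hω) measureReal_nonneg
    _ = q * P.real H := by rw [hPH, Finset.mul_sum]

/-- Two consecutive rounds: if `E` forces, given `H`, either an event of probability at most `1/2`
in round `t` or an event of probability at most `7/8` in round `t + 1`, each conditionally on the
past, then `E` has at most `15/16` of the probability of `H`. -/
lemma measureReal_two_rounds_le (μ : Measure Y) [IsProbabilityMeasure μ] {t : ℕ}
    {H E : Set (ℕ → Y)} (hH : DependsOn (fun ω => ω ∈ H) (Set.Iio t))
    {B₁ B₂ : (ℕ → Y) → Set Y} (hB₁ : DependsOn B₁ (Set.Iio t))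
    (hB₂ : DependsOn B₂ (Set.Iio (t + 1)))
    (h₁ : ∀ ω ∈ H, μ.real (B₁ ω) ≤ 1 / 2) (h₂ : ∀ ω ∈ H, μ.real (B₂ ω) ≤ 7 / 8)
    (hE : ∀ ω ∈ E, ω ∈ H ∧ (ω t ∈ B₁ ω ∨ ω (t + 1) ∈ B₂ ω)) :
    (Measure.infinitePi fun _ : ℕ => μ).real E ≤
      15 / 16 * (Measure.infinitePi fun _ : ℕ => μ).real H := by
  set P := Measure.infinitePi fun _ : ℕ => μ
  set K : Set (ℕ → Y) := {ω | ω ∈ H ∧ ω t ∈ B₁ ω}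
  have hK : DependsOn (fun ω => ω ∈ K) (Set.Iio (t + 1)) := by
    intro x y hxy
    have e1 := hH fun i (hi : i < t) => hxy i (Nat.lt_succ_of_lt hi)
    have e2 := hB₁ fun i (hi : i < t) => hxy i (Nat.lt_succ_of_lt hi)
    have e3 := hxy t (Nat.lt_succ_self t)
    simp only [K, Set.mem_ofPred_eq] at e1 ⊢
    rw [e1, e2, e3]
  have hHK : DependsOn (fun ω => ω ∈ H \ K) (Set.Iio (t + 1)) := by
    intro x y hxy
    have e1 := hH fun i (hi : i < t) => hxy i (Nat.lt_succ_of_lt hi)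
    have e2 := hK hxy
    simp only [Set.mem_sdiff] at e1 e2 ⊢
    rw [e1, e2]
  have hsub : E ⊆ K ∪ {ω | ω ∈ H \ K ∧ ω (t + 1) ∈ B₂ ω} := by
    intro ω hω
    obtain ⟨h, h'⟩ := hE ω hω
    by_cases hk : ω ∈ K
    · exact Or.inl hk
    · exact Or.inr ⟨⟨h, hk⟩, h'.resolve_left fun h'' => hk ⟨h, h''⟩⟩
  have b1 : P.real K ≤ 1 / 2 * P.real H := measureReal_fresh_le μ hH hB₁ h₁
  have b2 : P.real {ω | ω ∈ H \ K ∧ ω (t + 1) ∈ B₂ ω} ≤ 7 / 8 * P.real (H \ K) :=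
    measureReal_fresh_le μ hHK hB₂ fun ω hω => h₂ ω hω.1
  have b3 : P.real (H \ K) = P.real H - P.real K :=
    measureReal_sdiff (fun ω h => h.1) (measurableSet_of_dependsOn hK)
  have b4 := (measureReal_mono (μ := P) hsub).trans (measureReal_union_le _ _)
  linarith

end FreshRound

/-! ### Random proposals -/

section Sampling

/-- Uniformly random proposals: a node is active with probability `1/4`, only active nodes propose
a color, and an active node with a nonempty palette of at most `m` colors proposes one that is
uniformly distributed in the palette. -/
structure IsColorSampler {Ω : Type} [MeasurableSpace Ω] (κ : Measure Ω) (m : ℕ) (act : Set Ω)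
    (draw : Finset ℕ → Ω → Option ℕ) : Prop where
  act_prob : κ.real act = 1 / 4
  act_of_draw : ∀ {pal x c}, draw pal x = some c → x ∈ act
  draw_of_act : ∀ {pal : Finset ℕ} {x}, pal.Nonempty → x ∈ act → ∃ c ∈ pal, draw pal x = some c
  draw_prob : ∀ {pal : Finset ℕ} c, pal.Nonempty → pal.card ≤ m →
    κ.real {x | draw pal x = some c} ≤ 1 / (4 * pal.card)

variable {V Ω : Type} [Fintype V]

/-- More than half of the nodes of `U` are active. -/
def crowded (act : Set Ω) (U : Finset V) : Set (V → Ω) :=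
  {x | ∃ S ⊆ U, (∀ u ∈ S, x u ∈ act) ∧ U.card < 2 * S.card}

/-- With palettes `pal`, the node `v` proposes nothing or the same color as some node of `C`. -/
def collision (draw : Finset ℕ → Ω → Option ℕ) (C : Finset V) (pal : V → Finset ℕ) (v : V) :
    Set (V → Ω) :=
  {x | ∀ c, draw (pal v) (x v) = some c → ∃ u ∈ C, draw (pal u) (x u) = some c}

variable [MeasurableSpace Ω] {κ : Measure Ω} [IsProbabilityMeasure κ]

lemma measureReal_pi_eval (v : V) (S : Set Ω) :
    (Measure.pi fun _ : V => κ).real {x | x v ∈ S} = κ.real S := by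
  classical
  have : {x : V → Ω | x v ∈ S} = Set.univ.pi fun w => if w = v then S else Set.univ := by
    ext x
    simp only [Set.mem_ofPred_eq, Set.mem_pi, Set.mem_univ, true_implies]
    constructor
    · intro h w
      split_ifs with hw
      · exact hw ▸ h
      · trivial
    · intro h; simpa using h v
  rw [this, measureReal_def, Measure.pi_pi, measureReal_def,
    Finset.prod_eq_single v (fun w _ hw => by simp [hw]) (by simp)]
  simp

lemma measureReal_pi_eval₂ {u v : V} (huv : u ≠ v) (S S' : Set Ω) :
    (Measure.pi fun _ : V => κ).real {x | x u ∈ S ∧ x v ∈ S'} = κ.real S * κ.real S' := by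
  classical
  have : {x : V → Ω | x u ∈ S ∧ x v ∈ S'} =
      Set.univ.pi fun w => if w = u then S else if w = v then S' else Set.univ := by
    ext x
    simp only [Set.mem_ofPred_eq, Set.mem_pi, Set.mem_univ, true_implies]
    constructor
    · rintro ⟨h, h'⟩ w
      split_ifs with hw hw'
      · exact hw ▸ h
      · exact hw' ▸ h'
      · trivial
    · intro h
      exact ⟨by simpa using h u, by simpa [huv.symm] using h v⟩
  rw [this, measureReal_def, Measure.pi_pi, measureReal_def, measureReal_def, ← ENNReal.toReal_mul,
    Finset.prod_eq_mul u v huv (fun w _ hw => by simp [hw.1, hw.2]) (by simp) (by simp)]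
  simp [huv.symm]

variable {m : ℕ} {act : Set Ω} {draw : Finset ℕ → Ω → Option ℕ}

/-- Markov's inequality for the number of active nodes, whose mean is `U.card / 4`. -/
lemma measureReal_crowded_le [Finite Ω] [DiscreteMeasurableSpace Ω]
    (h : IsColorSampler κ m act draw) (U : Finset V) :
    (Measure.pi fun _ : V => κ).real (crowded act U) ≤ 1 / 2 := by
  classical
  set μ := Measure.pi fun _ : V => κ
  let f : (V → Ω) → ℝ := fun x => ∑ u ∈ U, Set.indicator {x : V → Ω | x u ∈ act} 1 x
  have hint : ∀ u, Integrable (Set.indicator {x : V → Ω | x u ∈ act} (1 : (V → Ω) → ℝ)) μ :=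
    fun u => Integrable.of_finite
  have hf : ∫ x, f x ∂μ = U.card / 4 := by
    rw [integral_finsetSum _ fun u _ => hint u]
    rw [Finset.sum_congr rfl fun u _ => integral_indicator_one (μ := μ) MeasurableSet.of_discrete]
    rw [Finset.sum_congr rfl fun u _ => (measureReal_pi_eval u act).trans h.act_prob]
    simp [div_eq_mul_inv]
  rcases U.eq_empty_or_nonempty with rfl | hU
  · have : crowded act (∅ : Finset V) = ∅ := by
      ext x
      simp [crowded, Finset.subset_empty]
    rw [this]; simp
  have hpos : (0 : ℝ) < U.card := by exact_mod_cast hU.card_pos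
  have hsub : crowded act U ⊆ {x | (U.card / 2 : ℝ) ≤ f x} := by
    rintro x ⟨S, hSU, hS, hc⟩
    have h1 : (S.card : ℝ) ≤ f x := by
      calc (S.card : ℝ) = ∑ u ∈ S, Set.indicator {x : V → Ω | x u ∈ act} (1 : (V → Ω) → ℝ) x := by
            rw [Finset.sum_congr rfl fun u hu => Set.indicator_of_mem
              (show x ∈ {x : V → Ω | x u ∈ act} from hS u hu) _]
            simp
        _ ≤ f x := Finset.sum_le_sum_of_subset_of_nonneg hSU fun u _ _ =>
            Set.indicator_nonneg (fun _ _ => zero_le_one) _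
    have h2 : (U.card : ℝ) < 2 * S.card := by exact_mod_cast hc
    simp only [Set.mem_ofPred_eq]
    linarith
  have hm := mul_meas_ge_le_integral_of_nonneg (μ := μ) (f := f)
    (Filter.Eventually.of_forall fun x => Finset.sum_nonneg fun u _ =>
      Set.indicator_nonneg (fun _ _ => zero_le_one) _) Integrable.of_finite (U.card / 2)
  rw [hf] at hm
  refine (measureReal_mono hsub).trans ?_
  by_contra hcon
  push Not at hcon
  nlinarith

/-- The proposal of `v` survives with probability at least `1/8` when at most twice as many nodes
compete as there are colors in the palette of `v`: `v` is active with probability `1/4`, and each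
competitor spoils the proposal with probability at most `1 / (16 * (pal v).card)`. -/
lemma measureReal_collision_le [Finite Ω] [DiscreteMeasurableSpace Ω]
    (h : IsColorSampler κ m act draw) {C : Finset V} {pal : V → Finset ℕ} {v : V} (hv : v ∉ C)
    (hne : (pal v).Nonempty) (hm : (pal v).card ≤ m) (hC : C.card ≤ 2 * (pal v).card) :
    (Measure.pi fun _ : V => κ).real (collision draw C pal v) ≤ 7 / 8 := by
  classical
  set μ := Measure.pi fun _ : V => κ
  have hp : (0 : ℝ) < (pal v).card := by exact_mod_cast hne.card_pos
  let D : V → Set (V → Ω) := fun u =>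
    ⋃ c ∈ pal v, {x | x u ∈ {y | draw (pal u) y = some c} ∧ x v ∈ {y | draw (pal v) y = some c}}
  have hsub : collision draw C pal v ⊆ {x | x v ∈ actᶜ} ∪ ⋃ u ∈ C, D u := by
    intro x hx
    by_cases ha : x v ∈ act
    · right
      obtain ⟨c, hc, hd⟩ := h.draw_of_act hne ha
      obtain ⟨u, hu, hu'⟩ := hx c hd
      simp only [D, Set.mem_iUnion]
      exact ⟨u, hu, c, hc, hu', hd⟩
    · exact Or.inl ha
  have hD : ∀ u ∈ C, μ.real (D u) ≤ 1 / (16 * (pal v).card) := by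
    intro u hu
    have huv : u ≠ v := fun e => hv (e ▸ hu)
    have hsum : ∑ c ∈ pal v, κ.real {y | draw (pal u) y = some c} ≤ 1 / 4 := by
      rw [← measureReal_biUnion_finset _ fun _ _ => MeasurableSet.of_discrete, ← h.act_prob]
      · refine measureReal_mono ?_
        intro y hy
        simp only [Set.mem_iUnion] at hy
        obtain ⟨c, _, hc⟩ := hy
        exact h.act_of_draw hc
      · intro a _ b _ hab
        refine Set.disjoint_left.2 fun y (hy : _ = _) (hy' : _ = _) => hab ?_
        exact Option.some_injective _ (hy.symm.trans hy')
    calc μ.real (D u) ≤ ∑ c ∈ pal v, μ.real {x | x u ∈ {y | draw (pal u) y = some c} ∧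
          x v ∈ {y | draw (pal v) y = some c}} := measureReal_biUnion_finset_le _ _
      _ ≤ ∑ c ∈ pal v, κ.real {y | draw (pal u) y = some c} * (1 / (4 * (pal v).card)) := by
          refine Finset.sum_le_sum fun c _ => ?_
          rw [measureReal_pi_eval₂ huv]
          exact mul_le_mul_of_nonneg_left (h.draw_prob c hne hm) measureReal_nonneg
      _ = (∑ c ∈ pal v, κ.real {y | draw (pal u) y = some c}) * (1 / (4 * (pal v).card)) := by
          rw [Finset.sum_mul]
      _ ≤ 1 / 4 * (1 / (4 * (pal v).card)) := mul_le_mul_of_nonneg_right hsum (by positivity)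
      _ = 1 / (16 * (pal v).card) := by field_simp; norm_num
  have hA : μ.real {x | x v ∈ actᶜ} = 3 / 4 := by
    rw [measureReal_pi_eval, probReal_compl_eq_one_sub MeasurableSet.of_discrete, h.act_prob]
    norm_num
  have hU : μ.real (⋃ u ∈ C, D u) ≤ 1 / 8 := by
    calc μ.real (⋃ u ∈ C, D u) ≤ ∑ u ∈ C, μ.real (D u) := measureReal_biUnion_finset_le _ _
      _ ≤ ∑ u ∈ C, 1 / (16 * (pal v).card : ℝ) := Finset.sum_le_sum hD
      _ = C.card / (16 * (pal v).card : ℝ) := by simp [div_eq_mul_inv]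
      _ ≤ 1 / 8 := by
          rw [div_le_div_iff₀ (by positivity) (by norm_num)]
          have : (C.card : ℝ) ≤ 2 * (pal v).card := by exact_mod_cast hC
          linarith
  have := (measureReal_mono (μ := μ) hsub).trans (measureReal_union_le _ _)
  linarith

end Sampling

/-! ### Two rounds of competition -/

section TwoRounds

variable {V Ω : Type}

/-- The color proposed by a node: nodes that hold a color do not propose. -/
def proposal (draw : Finset ℕ → Ω → Option ℕ) (fix : Option ℕ) (pal : Finset ℕ) (x : Ω) :
    Option ℕ :=
  if fix = none then draw pal x else none

lemma proposal_eq_some {draw : Finset ℕ → Ω → Option ℕ} {fix : Option ℕ} {pal : Finset ℕ} {x : Ω}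
    {c : ℕ} : proposal draw fix pal x = some c ↔ fix = none ∧ draw pal x = some c := by
  unfold proposal
  split_ifs with h <;> simp [h]

/-- Two consecutive rounds in which the node `v` competes for a color and fails.  Here `F₀, pal₀`
are the colors and palettes before the first of the two rounds and `F₁, pal₁` those before the
second one, `x₁, x₂` are the coins of the two rounds, and `N₀ ⊇ N₁ ⊇ N₂` are the competitors of `v`
before the two rounds, in the first one and in the second one. -/
structure FailsTwice (draw : Finset ℕ → Ω → Option ℕ) (F₀ F₁ : V → Option ℕ)
    (pal₀ pal₁ : V → Finset ℕ) (x₁ x₂ : V → Ω) (v : V) (N₀ N₁ N₂ : Finset V) (D : ℕ) : Prop where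
  notMem : v ∉ N₀
  sub₁ : N₁ ⊆ N₀
  sub₂ : N₂ ⊆ N₁
  card_le : N₀.card ≤ D
  keep : ∀ u ∈ N₀, F₀ u ≠ none → F₁ u = F₀ u
  gain : ∀ u ∈ N₀, F₀ u = none → ∀ c, F₁ u = some c → proposal draw (F₀ u) (pal₀ u) (x₁ u) = some c
  palette : ∀ c, c ∈ pal₁ v ↔ c ∈ Finset.Icc 1 (D + 1) ∧
    ¬ ∃ u ∈ N₁, F₀ u = some c ∨ proposal draw (F₀ u) (pal₀ u) (x₁ u) = some c
  none_mid : F₁ v = none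
  fail : ∀ c, draw (pal₁ v) (x₂ v) = some c →
    ∃ u ∈ N₂, F₁ u = some c ∨ proposal draw (F₁ u) (pal₁ u) (x₂ u) = some c

/-- If at most half of the uncolored competitors of `v` are active in the first round, then the
palette of `v` for the second round has at least half as many colors as `v` has competitors: a
competitor that holds a color removes only that one from the palette, and an active one removes
only its proposal. -/
lemma FailsTwice.crowded_or_collision {draw : Finset ℕ → Ω → Option ℕ} {act : Set Ω}
    (hact : ∀ {pal x c}, draw pal x = some c → x ∈ act)
    (hmem : ∀ {pal x c}, draw pal x = some c → c ∈ pal) {F₀ F₁ : V → Option ℕ}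
    {pal₀ pal₁ : V → Finset ℕ} {x₁ x₂ : V → Ω} {v : V} {N₀ N₁ N₂ : Finset V} {D : ℕ}
    (h : FailsTwice draw F₀ F₁ pal₀ pal₁ x₁ x₂ v N₀ N₁ N₂ D) :
    x₁ ∈ crowded act (N₀.filter fun u => F₀ u = none) ∨
      v ∉ N₀.filter (fun u => F₁ u = none) ∧ (pal₁ v).Nonempty ∧ (pal₁ v).card ≤ D + 1 ∧
      (N₀.filter fun u => F₁ u = none).card ≤ 2 * (pal₁ v).card ∧
      x₂ ∈ collision draw (N₀.filter fun u => F₁ u = none) pal₁ v := by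
  classical
  by_cases hcr : x₁ ∈ crowded act (N₀.filter fun u => F₀ u = none)
  · exact Or.inl hcr
  right
  set U := N₀.filter fun u => F₀ u = none
  set W := N₀.filter fun u => ¬ F₀ u = none
  set S := U.filter fun u => proposal draw (F₀ u) (pal₀ u) (x₁ u) ≠ none
  have hS : 2 * S.card ≤ U.card := by
    by_contra hlt
    refine hcr ⟨S, Finset.filter_subset _ _, fun u hu => ?_, by omega⟩
    obtain ⟨c, hc⟩ := Option.ne_none_iff_exists'.1 (Finset.mem_filter.1 hu).2
    exact hact (proposal_eq_some.1 hc).2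
  have hUW : U.card + W.card = N₀.card := Finset.card_filter_add_card_filter_not _
  have hcover : Finset.Icc 1 (D + 1) ⊆ pal₁ v ∪ (W.image (fun u => (F₀ u).getD 0) ∪
      S.image fun u => (proposal draw (F₀ u) (pal₀ u) (x₁ u)).getD 0) := by
    intro c hc
    by_cases hp : c ∈ pal₁ v
    · exact Finset.mem_union_left _ hp
    refine Finset.mem_union_right _ ?_
    have : ∃ u ∈ N₁, F₀ u = some c ∨ proposal draw (F₀ u) (pal₀ u) (x₁ u) = some c := by
      by_contra hcon
      exact hp ((h.palette c).2 ⟨hc, hcon⟩)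
    obtain ⟨u, hu, hu' | hu'⟩ := this
    · refine Finset.mem_union_left _ (Finset.mem_image.2 ⟨u, ?_, by simp [hu']⟩)
      exact Finset.mem_filter.2 ⟨h.sub₁ hu, by simp [hu']⟩
    · refine Finset.mem_union_right _ (Finset.mem_image.2 ⟨u, ?_, by simp [hu']⟩)
      exact Finset.mem_filter.2
        ⟨Finset.mem_filter.2 ⟨h.sub₁ hu, (proposal_eq_some.1 hu').1⟩, by simp [hu']⟩
  have hcard : D + 1 ≤ (pal₁ v).card + (W.card + S.card) := by
    have h1 := Finset.card_le_card hcover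
    rw [Nat.card_Icc] at h1
    have h2 := Finset.card_union_le (pal₁ v) (W.image (fun u => (F₀ u).getD 0) ∪
      S.image fun u => (proposal draw (F₀ u) (pal₀ u) (x₁ u)).getD 0)
    have h3 := Finset.card_union_le (W.image (fun u => (F₀ u).getD 0))
      (S.image fun u => (proposal draw (F₀ u) (pal₀ u) (x₁ u)).getD 0)
    have h4 := Finset.card_image_le (s := W) (f := fun u => (F₀ u).getD 0)
    have h5 := Finset.card_image_le (s := S)
      (f := fun u => (proposal draw (F₀ u) (pal₀ u) (x₁ u)).getD 0)
    omega
  have hC : (N₀.filter fun u => F₁ u = none).card ≤ U.card := by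
    refine Finset.card_le_card fun u hu => ?_
    obtain ⟨hu0, hu1⟩ := Finset.mem_filter.1 hu
    refine Finset.mem_filter.2 ⟨hu0, ?_⟩
    by_contra hne
    exact hne (h.keep u hu0 hne ▸ hu1)
  have hD := h.card_le
  refine ⟨fun hv => h.notMem (Finset.mem_filter.1 hv).1, Finset.card_pos.1 (by omega), ?_,
    by omega, fun c hc => ?_⟩
  · have : pal₁ v ⊆ Finset.Icc 1 (D + 1) := fun c hc => ((h.palette c).1 hc).1
    simpa using Finset.card_le_card this
  · obtain ⟨hp, hfree⟩ := (h.palette c).1 (by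
      exact hmem hc)
    obtain ⟨u, hu, hu' | hu'⟩ := h.fail c hc
    · refine absurd ⟨u, h.sub₂ hu, ?_⟩ hfree
      have hu0 := h.sub₁ (h.sub₂ hu)
      by_cases h0 : F₀ u = none
      · exact Or.inr (h.gain u hu0 h0 c hu')
      · exact Or.inl (h.keep u hu0 h0 ▸ hu')
    · obtain ⟨h1, h2⟩ := proposal_eq_some.1 hu'
      exact ⟨u, Finset.mem_filter.2 ⟨h.sub₁ (h.sub₂ hu), h1⟩, h2⟩

end TwoRounds

/-! ### The algorithm -/

section Algorithm

open Nat in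
/-- The coins of a round: an identifier (of which only the one drawn on waking up is used), a number
that decides about activity, and an index from which a color of the palette is derived. -/
abbrev Coin (N m : ℕ) : Type := Fin (N + 1) × Fin 4 × Fin (m !)

/-- The coins with which a node proposes a color. -/
def activeCoins (N m : ℕ) : Set (Coin N m) := {x | x.2.1 = 0}

open Classical in
/-- The proposal from the palette `pal`.  The index is reduced modulo `pal.card`, which preserves
uniformity since `pal.card ∣ m !` for `0 < pal.card ≤ m`. -/
def drawColor {N m : ℕ} (pal : Finset ℕ) (x : Coin N m) : Option ℕ :=
  if h : x ∈ activeCoins N m ∧ pal.Nonempty then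
    some (pal.orderEmbOfFin rfl ⟨x.2.2 % pal.card, Nat.mod_lt _ h.2.card_pos⟩)
  else none

lemma mem_of_drawColor {N m : ℕ} {pal : Finset ℕ} {x : Coin N m} {c : ℕ}
    (h : drawColor pal x = some c) : c ∈ pal := by
  unfold drawColor at h
  split_ifs at h with h'
  cases h
  exact Finset.orderEmbOfFin_mem _ _ _

/-- What a node remembers about one of its colorings: its color, if it holds one, the palette of
colors that it may propose next, the identifiers of the neighbors that it respects, and the degree
that limits the range of its colors. -/
structure Slot where
  fix : Option ℕ
  pal : Finset ℕ
  cons : Finset ℕ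
  deg : ℕ

/-- The message of a node: its identifier and, for each of its colorings, its color and its
proposal. -/
structure Message where
  id : ℕ
  fix : ℕ → Option ℕ
  pick : ℕ → Option ℕ

/-- The color `c` is held or proposed by some sender, in the coloring `a`. -/
def Taken (M : Multiset Message) (a c : ℕ) : Prop :=
  ∃ x ∈ M, x.fix a = some c ∨ x.pick a = some c

open Classical in
/-- The colors of `{1, …, D + 1}` that no sender holds or proposes. -/
def freeColors (M : Multiset Message) (a D : ℕ) : Finset ℕ :=
  (Finset.Icc 1 (D + 1)).filter fun c => ¬ Taken M a c

lemma mem_freeColors {M : Multiset Message} {a D c : ℕ} :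
    c ∈ freeColors M a D ↔ c ∈ Finset.Icc 1 (D + 1) ∧ ¬ Taken M a c := by
  simp [freeColors]

open Classical in
/-- One round of the base coloring: a color is given up if a neighbor holds the same one or if it
exceeds the current degree by more than one, and a proposal becomes the color of its node if it is
in range and no neighbor holds or proposes it. -/
def baseUpdate (s : Slot) (p : Option ℕ) (M : Multiset Message) : Slot where
  fix := if s.fix = none then p.filter fun c => c ≤ M.card + 1 ∧ ¬ Taken M 0 c
    else s.fix.filter fun c => c ≤ M.card + 1 ∧ ∀ x ∈ M, x.fix 0 ≠ some c
  pal := freeColors M 0 M.card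
  cons := (M.map Message.id).toFinset
  deg := M.card

open Classical in
/-- The messages from senders in `cons`. -/
def heard (cons : Finset ℕ) (M : Multiset Message) : Multiset Message :=
  M.filter fun x => x.id ∈ cons

open Classical in
/-- One round of an extension of the base coloring, from age `a` to age `a + 1`: colors are kept, and
only neighbors from which the node has heard in all rounds since age `0` are respected. -/
def extUpdate (a : ℕ) (s : Slot) (p : Option ℕ) (M : Multiset Message) : Slot where
  fix := if s.fix = none then p.filter fun c => ¬ Taken (heard s.cons M) a c else s.fix
  pal := freeColors (heard s.cons M) a s.deg
  cons := ((heard s.cons M).map Message.id).toFinset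
  deg := s.deg

/-- The state of a node.  Slot `0` is its part of the base coloring; slot `a` is its part of the
extension that was started, from the base coloring, `a` rounds ago. -/
structure NodeState where
  id : Option ℕ
  slot : ℕ → Slot

/-- The coloring algorithm: the base coloring is continued forever, and in each round an extension
of it is started and output `j` rounds later. -/
def coloringAlgorithm (N m j : ℕ) : DistAlgorithm where
  State := NodeState
  Msg := Message
  Coin := Coin N m
  fintypeCoin := inferInstance
  nonemptyCoin := ⟨0, 0, 0, Nat.factorial_pos m⟩
  init := ⟨none, fun _ => ⟨none, ∅, ∅, 0⟩⟩
  send s x := ⟨s.id.getD x.1, fun a => (s.slot a).fix,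
    fun a => proposal drawColor (s.slot a).fix (s.slot a).pal x⟩
  update s x M := ⟨some (s.id.getD x.1), fun a => match a with
    | 0 => baseUpdate (s.slot 0) (proposal drawColor (s.slot 0).fix (s.slot 0).pal x) M
    | a + 1 => extUpdate a (s.slot a) (proposal drawColor (s.slot a).fix (s.slot a).pal x) M⟩
  output s := (s.slot j).fix

lemma uniform_real_eq_card_div {Ω : Type} [Fintype Ω] [Nonempty Ω] [MeasurableSpace Ω]
    [DiscreteMeasurableSpace Ω] (S : Finset Ω) :
    (PMF.uniformOfFintype Ω).toMeasure.real (S : Set Ω) = S.card / Fintype.card Ω := by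
  rw [measureReal_def, PMF.toMeasure_uniformOfFintype_apply _ MeasurableSet.of_discrete]
  simp

lemma card_mod_eq_mul_le {M p : ℕ} (hp : 0 < p) (hd : p ∣ M) (k : ℕ) :
    (Finset.univ.filter fun i : Fin M => (i : ℕ) % p = k).card * p ≤ M := by
  have h1 : (Finset.univ.filter fun i : Fin M => (i : ℕ) % p = k).card ≤
      ((Finset.range M).filter fun i => i ≡ k [MOD p]).card := by
    refine Finset.card_le_card_of_injOn Fin.val ?_ Fin.val_injective.injOn
    intro i hi
    have hi' : (i : ℕ) % p = k := by simpa using hi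
    simp [Nat.ModEq, ← hi']
  rw [← Nat.count_eq_card_filter_range, Nat.count_modEq_card _ hp, Nat.mod_eq_zero_of_dvd hd] at h1
  simp only [not_lt_zero, if_false, add_zero] at h1
  calc _ ≤ M / p * p := Nat.mul_le_mul_right _ h1
    _ = M := Nat.div_mul_cancel hd

instance (A : DistAlgorithm) : DiscreteMeasurableSpace A.Coin := ⟨fun _ => trivial⟩

lemma coin_real_box (N m j : ℕ) (I : Finset (Fin m.factorial)) :
    (PMF.uniformOfFintype (coloringAlgorithm N m j).Coin).toMeasure.real
      ({x | x.2.1 = 0 ∧ x.2.2 ∈ I} : Set (Coin N m)) = I.card / (4 * m.factorial) := by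
  have h1 : ({x | x.2.1 = 0 ∧ x.2.2 ∈ I} : Set (Coin N m)) =
      ((Finset.univ ×ˢ ({0} ×ˢ I) : Finset (Coin N m)) : Set (Coin N m)) := by
    ext x
    simp only [Set.mem_ofPred_eq, Finset.mem_coe, Finset.mem_product, Finset.mem_univ, true_and,
      Finset.mem_singleton]
  have h2 : Fintype.card (coloringAlgorithm N m j).Coin = (N + 1) * (4 * m.factorial) := by
    change Fintype.card (Coin N m) = _
    simp
  have h3 : (Finset.univ ×ˢ ({0} ×ˢ I) : Finset (Coin N m)).card = (N + 1) * I.card := by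
    rw [Finset.card_product, Finset.card_product]
    simp
  have h4 : (m.factorial : ℝ) ≠ 0 := by exact_mod_cast m.factorial_ne_zero
  have h5 : (N + 1 : ℝ) ≠ 0 := by positivity
  rw [h1]
  refine (uniform_real_eq_card_div (Ω := (coloringAlgorithm N m j).Coin) _).trans ?_
  refine (congrArg₂ (fun a b : ℕ => (a : ℝ) / b) h3 h2).trans ?_
  push_cast
  field_simp

lemma isColorSampler (N m j : ℕ) :
    IsColorSampler (PMF.uniformOfFintype (coloringAlgorithm N m j).Coin).toMeasure m
      (activeCoins N m) drawColor where
  act_prob := by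
    have h3 : (m.factorial : ℝ) ≠ 0 := by exact_mod_cast m.factorial_ne_zero
    have h1 : activeCoins N m = {x | x.2.1 = 0 ∧ x.2.2 ∈ Finset.univ} := by simp [activeCoins]
    rw [h1]
    refine (coin_real_box N m j Finset.univ).trans ?_
    rw [Finset.card_univ, Fintype.card_fin]
    field_simp
  act_of_draw := by
    intro pal x c h
    unfold drawColor at h
    split_ifs at h with h'
    exact h'.1
  draw_of_act := by
    intro pal x hp hx
    refine ⟨_, ?_, dif_pos ⟨hx, hp⟩⟩
    exact Finset.orderEmbOfFin_mem _ _ _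
  draw_prob := by
    intro pal c hp hm
    by_cases hc : c ∈ pal
    swap
    · have : {x : (coloringAlgorithm N m j).Coin | drawColor (N := N) (m := m) pal x = some c} = ∅ :=
        Set.eq_empty_of_forall_notMem fun x hx => hc (mem_of_drawColor hx)
      rw [this]
      simp
    obtain ⟨k, hk⟩ : ∃ k, pal.orderEmbOfFin rfl k = c := by
      have : c ∈ Set.range (pal.orderEmbOfFin rfl) := by
        rw [Finset.range_orderEmbOfFin]; exact hc
      exact this
    set I := Finset.univ.filter fun i : Fin m.factorial => (i : ℕ) % pal.card = k
    have h1 : {x : (coloringAlgorithm N m j).Coin | drawColor (N := N) (m := m) pal x = some c} ⊆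
        ({x | x.2.1 = 0 ∧ x.2.2 ∈ I} : Set (Coin N m)) := by
      intro x (hx : drawColor (N := N) (m := m) pal x = some c)
      unfold drawColor at hx
      split_ifs at hx with h'
      have h2 := (pal.orderEmbOfFin rfl).injective ((Option.some_injective _ hx).trans hk.symm)
      exact ⟨h'.1, Finset.mem_filter.2 ⟨Finset.mem_univ _, congrArg Fin.val h2⟩⟩
    have h3 : (I.card : ℝ) * pal.card ≤ m.factorial := by
      exact_mod_cast card_mod_eq_mul_le hp.card_pos (Nat.dvd_factorial hp.card_pos hm) k
    have h4 : (0 : ℝ) < m.factorial := by exact_mod_cast m.factorial_pos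
    have h5 : (0 : ℝ) < pal.card := by exact_mod_cast hp.card_pos
    refine (measureReal_mono h1).trans ((coin_real_box N m j I).le.trans ?_)
    rw [div_le_div_iff₀ (by positivity) (by positivity)]
    linarith

end Algorithm

/-! ### Executions -/

section Execution

variable {N m j : ℕ} {V : Type} {G : DynGraph V}

lemma awake_of_adj_left {r : ℕ} {u v : V} (h : (G.graph r).Adj u v) : u ∈ G.awake r :=
  G.awake_of_adj r u v h

lemma awake_of_adj_right {r : ℕ} {u v : V} (h : (G.graph r).Adj u v) : v ∈ G.awake r :=
  G.awake_of_adj r v u h.symm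

/-- The edge from `v` to `u` is present in all rounds of `[s, r]`. -/
def Persists (G : DynGraph V) (s r : ℕ) (v u : V) : Prop := ∀ l ∈ Set.Icc s r, (G.graph l).Adj v u

lemma Persists.symm {s r : ℕ} {u v : V} (h : Persists G s r v u) : Persists G s r u v :=
  fun l hl => (h l hl).symm

lemma Persists.mono {s r r' : ℕ} {u v : V} (h : Persists G s r' v u) (hr : r ≤ r') :
    Persists G s r v u := fun l hl => h l ⟨hl.1, hl.2.trans hr⟩

lemma persists_succ {s r : ℕ} {u v : V} (hs : s ≤ r) :
    Persists G s (r + 1) v u ↔ Persists G s r v u ∧ (G.graph (r + 1)).Adj v u := by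
  refine ⟨fun h => ⟨h.mono (Nat.le_succ r), h _ ⟨by omega, le_rfl⟩⟩, fun h l hl => ?_⟩
  rcases Nat.le_succ_iff.1 hl.2 with h' | rfl
  · exact h.1 l ⟨hl.1, h'⟩
  · exact h.2

/-- The identifier drawn by `v` in round `r`. -/
def drawnId (ω : (coloringAlgorithm N m j).Tape V) (r : ℕ) (v : V) : Fin (N + 1) :=
  Prod.fst (α := Fin (N + 1)) (ω r v)

/-- The identifiers drawn by different nodes in the rounds before `t` are different. -/
def DistinctIds (ω : (coloringAlgorithm N m j).Tape V) (t : ℕ) : Prop :=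
  ∀ r < t, ∀ s < t, ∀ u v : V, u ≠ v → drawnId ω r u ≠ drawnId ω s v

lemma DistinctIds.mono {ω : (coloringAlgorithm N m j).Tape V} {t t' : ℕ}
    (h : DistinctIds ω t') (ht : t ≤ t') : DistinctIds ω t :=
  fun r hr s hs => h r (by omega) s (by omega)

variable [Fintype V] (G) (ω : (coloringAlgorithm N m j).Tape V)

/-- The slot `a` of the node `v` at the beginning of round `r`. -/
def slotAt (a r : ℕ) (v : V) : Slot :=
  NodeState.slot ((coloringAlgorithm N m j).stateAt G ω r v) a

/-- The color that `v` holds in the coloring `a` at the beginning of round `r`. -/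
abbrev fixAt (a r : ℕ) (v : V) : Option ℕ := (slotAt G ω a r v).fix

/-- The palette of `v` in the coloring `a` at the beginning of round `r`. -/
abbrev palAt (a r : ℕ) (v : V) : Finset ℕ := (slotAt G ω a r v).pal

/-- The proposal of `v` in round `r` in the coloring `a`. -/
abbrev pickAt (a r : ℕ) (v : V) : Option ℕ :=
  proposal (drawColor (N := N) (m := m)) (fixAt G ω a r v) (palAt G ω a r v) (ω r v)

/-- The identifier under which `v` sends in round `r`. -/
def idAt (r : ℕ) (v : V) : ℕ :=
  (NodeState.id ((coloringAlgorithm N m j).stateAt G ω r v)).getD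
    (Prod.fst (α := Fin (N + 1)) (ω r v) : Fin (N + 1))

open Classical in
/-- The current neighbors of `v` in round `r`. -/
def DynGraph.neighbors (r : ℕ) (v : V) : Finset V :=
  Finset.univ.filter fun u => (G.graph r).Adj v u

lemma mem_neighbors {r : ℕ} {u v : V} : u ∈ G.neighbors r v ↔ (G.graph r).Adj v u := by
  simp [DynGraph.neighbors]

/-- The message that `u` broadcasts in round `r`. -/
def messageOf (r : ℕ) (u : V) : Message :=
  ⟨idAt G ω r u, fun a => fixAt G ω a r u, fun a => pickAt G ω a r u⟩

/-- The messages that `v` receives in round `r`. -/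
def inbox (r : ℕ) (v : V) : Multiset Message := (G.neighbors r v).val.map (messageOf G ω r)

lemma mem_inbox {r : ℕ} {v : V} {x : Message} :
    x ∈ inbox G ω r v ↔ ∃ u, (G.graph r).Adj v u ∧ messageOf G ω r u = x := by
  simp [inbox, ← mem_neighbors]

lemma card_inbox (r : ℕ) (v : V) : (inbox G ω r v).card = (G.neighbors r v).card := by
  simp [inbox]

variable {G ω}

lemma stateAt_succ_of_awake {r : ℕ} {v : V} (hv : v ∈ G.awake r) :
    (coloringAlgorithm N m j).stateAt G ω (r + 1) v =
      (⟨some (idAt G ω r v), fun a => match a with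
        | 0 => baseUpdate (slotAt G ω 0 r v) (pickAt G ω 0 r v) (inbox G ω r v)
        | a + 1 => extUpdate a (slotAt G ω a r v) (pickAt G ω a r v) (inbox G ω r v)⟩ :
          NodeState) := by
  exact if_pos hv

lemma slotAt_zero_succ {r : ℕ} {v : V} (hv : v ∈ G.awake r) :
    slotAt G ω 0 (r + 1) v =
      baseUpdate (slotAt G ω 0 r v) (pickAt G ω 0 r v) (inbox G ω r v) := by
  rw [slotAt, stateAt_succ_of_awake hv]

lemma slotAt_succ_succ (a : ℕ) {r : ℕ} {v : V} (hv : v ∈ G.awake r) :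
    slotAt G ω (a + 1) (r + 1) v =
      extUpdate a (slotAt G ω a r v) (pickAt G ω a r v) (inbox G ω r v) := by
  rw [slotAt, stateAt_succ_of_awake hv]

lemma idAt_succ {r : ℕ} {v : V} (hv : v ∈ G.awake r) : idAt G ω (r + 1) v = idAt G ω r v := by
  rw [idAt, stateAt_succ_of_awake hv]
  rfl

lemma stateAt_succ_of_not_awake {r : ℕ} {v : V} (hv : v ∉ G.awake r) :
    (coloringAlgorithm N m j).stateAt G ω (r + 1) v = (coloringAlgorithm N m j).stateAt G ω r v :=
  if_neg hv

lemma stateAt_of_not_awake {r : ℕ} {v : V} (hv : v ∉ G.awake r) :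
    (coloringAlgorithm N m j).stateAt G ω (r + 1) v = (coloringAlgorithm N m j).init := by
  induction r with
  | zero => exact if_neg hv
  | succ r ih =>
    rw [stateAt_succ_of_not_awake hv]
    exact ih fun h => hv (G.awake_mono (Nat.le_succ r) h)

/-- An awake node sends under the identifier that it drew in the round in which it woke up. -/
lemma exists_idAt_eq {r : ℕ} {v : V} (hv : v ∈ G.awake r) :
    ∃ s ≤ r, idAt G ω r v = drawnId ω s v := by
  induction r with
  | zero => exact absurd hv (by simp [G.awake_zero])
  | succ r ih =>
    by_cases h : v ∈ G.awake r
    · obtain ⟨s, hs, e⟩ := ih h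
      exact ⟨s, by omega, (idAt_succ h).trans e⟩
    · refine ⟨r + 1, le_rfl, ?_⟩
      rw [idAt, stateAt_of_not_awake h]
      rfl

lemma DistinctIds.idAt_inj {t r : ℕ} (h : DistinctIds ω t) (hr : r < t) {u v : V}
    (hu : u ∈ G.awake r) (hv : v ∈ G.awake r) (he : idAt G ω r u = idAt G ω r v) : u = v := by
  by_contra hne
  obtain ⟨s, hs, e⟩ := exists_idAt_eq (ω := ω) hu
  obtain ⟨s', hs', e'⟩ := exists_idAt_eq (ω := ω) hv
  exact h s (by omega) s' (by omega) u v hne (Fin.ext (e.symm.trans (he.trans e')))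

/-! ### Colors stay in range -/

/-- Colors and palettes are within the range given by the degree stored with them; for the base
coloring it is the current degree, for an extension the degree at its start (`ext_deg`). -/
lemma slot_range (a r : ℕ) (v : V) :
    (∀ c ∈ palAt G ω a r v, 1 ≤ c ∧ c ≤ (slotAt G ω a r v).deg + 1) ∧
      ∀ c, fixAt G ω a r v = some c → 1 ≤ c ∧ c ≤ (slotAt G ω a r v).deg + 1 := by
  induction r generalizing a with
  | zero => constructor <;> intro c hc <;> cases hc
  | succ r ih =>
    by_cases hv : v ∈ G.awake r
    swap
    · have e : slotAt G ω a (r + 1) v = slotAt G ω a r v := by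
        rw [slotAt, stateAt_succ_of_not_awake hv]; rfl
      simpa only [fixAt, palAt, e] using ih a
    have hfree : ∀ M b D c, c ∈ freeColors M b D → 1 ≤ c ∧ c ≤ D + 1 := fun M b D c hc =>
      Finset.mem_Icc.1 (mem_freeColors.1 hc).1
    have hpick : ∀ b c, pickAt G ω b r v = some c →
        1 ≤ c ∧ c ≤ (slotAt G ω b r v).deg + 1 := fun b c hc =>
      (ih b).1 c (mem_of_drawColor (proposal_eq_some.1 hc).2)
    cases a with
    | zero =>
      simp only [fixAt, palAt, slotAt_zero_succ hv]
      refine ⟨fun c hc => hfree _ _ _ c hc, fun c hc => ?_⟩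
      simp only [baseUpdate] at hc ⊢
      split_ifs at hc with h
      · simp only [Option.filter_eq_some_iff, decide_eq_true_eq] at hc
        exact ⟨(hpick 0 c hc.1).1, hc.2.1⟩
      · simp only [Option.filter_eq_some_iff, decide_eq_true_eq] at hc
        exact ⟨((ih 0).2 c hc.1).1, hc.2.1⟩
    | succ a =>
      simp only [fixAt, palAt, slotAt_succ_succ a hv]
      refine ⟨fun c hc => hfree _ _ _ c hc, fun c hc => ?_⟩
      simp only [extUpdate] at hc ⊢
      split_ifs at hc with h
      · simp only [Option.filter_eq_some_iff, decide_eq_true_eq] at hc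
        exact hpick a c hc.1
      · exact (ih a).2 c hc

/-! ### The base coloring -/

lemma taken_inbox {r : ℕ} {v : V} {a c : ℕ} : Taken (inbox G ω r v) a c ↔
    ∃ u, (G.graph r).Adj v u ∧ (fixAt G ω a r u = some c ∨ pickAt G ω a r u = some c) := by
  constructor
  · rintro ⟨x, hx, h⟩
    obtain ⟨u, hu, rfl⟩ := (mem_inbox G ω).1 hx
    exact ⟨u, hu, h⟩
  · rintro ⟨u, hu, h⟩
    exact ⟨_, (mem_inbox G ω).2 ⟨u, hu, rfl⟩, h⟩

/-- A node holds the base color `c` after round `r` if and only if it proposed `c` or held it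
before, and no rule prevents it from holding `c`. -/
lemma base_fix_iff {r : ℕ} {v : V} (hv : v ∈ G.awake r) {c : ℕ} :
    fixAt G ω 0 (r + 1) v = some c ↔ c ≤ (G.neighbors r v).card + 1 ∧
      (∀ u, (G.graph r).Adj v u → fixAt G ω 0 r u ≠ some c) ∧
      (fixAt G ω 0 r v = some c ∨ pickAt G ω 0 r v = some c ∧
        ∀ u, (G.graph r).Adj v u → pickAt G ω 0 r u ≠ some c) := by
  rw [fixAt, slotAt_zero_succ hv]
  simp only [baseUpdate]
  rw [card_inbox]
  split_ifs with h
  · simp only [Option.filter_eq_some_iff, decide_eq_true_eq, taken_inbox, h]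
    constructor
    · rintro ⟨h1, h2, h3⟩
      refine ⟨h2, fun u hu hc => h3 ⟨u, hu, Or.inl hc⟩, Or.inr ⟨h1, fun u hu hc => ?_⟩⟩
      exact h3 ⟨u, hu, Or.inr hc⟩
    · rintro ⟨h1, h2, h3⟩
      have h4 := h3.resolve_left (by simp)
      exact ⟨h4.1, h1, fun ⟨u, hu, hc⟩ => hc.elim (h2 u hu) (h4.2 u hu)⟩
  · simp only [Option.filter_eq_some_iff, decide_eq_true_eq]
    constructor
    · rintro ⟨h1, h2, h3⟩
      exact ⟨h2, fun u hu => h3 _ ((mem_inbox G ω).2 ⟨u, hu, rfl⟩), Or.inl h1⟩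
    · rintro ⟨h1, h2, h3⟩
      refine ⟨h3.resolve_right fun h4 => h (proposal_eq_some.1 h4.1).1, h1, fun x hx => ?_⟩
      obtain ⟨u, hu, rfl⟩ := (mem_inbox G ω).1 hx
      exact h2 u hu

lemma base_pal_iff {r : ℕ} {v : V} (hv : v ∈ G.awake r) {c : ℕ} :
    c ∈ palAt G ω 0 (r + 1) v ↔ c ∈ Finset.Icc 1 ((G.neighbors r v).card + 1) ∧
      ¬ ∃ u, (G.graph r).Adj v u ∧ (fixAt G ω 0 r u = some c ∨ pickAt G ω 0 r u = some c) := by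
  rw [palAt, slotAt_zero_succ hv]
  simp only [baseUpdate, mem_freeColors, taken_inbox, card_inbox]

/-- The base coloring is proper on the current graph: a node that keeps its color blocks the color
for its neighbors, and two neighbors cannot succeed with the same proposal. -/
lemma base_proper {r : ℕ} {u v : V} (h : (G.graph r).Adj u v) {c : ℕ}
    (hu : fixAt G ω 0 (r + 1) u = some c) : fixAt G ω 0 (r + 1) v ≠ some c := by
  intro hv
  obtain ⟨-, hu1, hu2⟩ := (base_fix_iff (awake_of_adj_left h)).1 hu
  obtain ⟨-, hv1, hv2⟩ := (base_fix_iff (awake_of_adj_right h)).1 hv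
  have hu3 := hu2.resolve_left (hv1 u h.symm)
  have hv3 := hv2.resolve_left (hu1 v h)
  exact hu3.2 v h hv3.1

/-- A base color survives a round in which the edges at its node do not change. -/
lemma base_keep {r : ℕ} {v : V} (hv : v ∈ G.awake r)
    (hadj : ∀ u, (G.graph (r + 1)).Adj v u ↔ (G.graph r).Adj v u) {c : ℕ}
    (h : fixAt G ω 0 (r + 1) v = some c) : fixAt G ω 0 (r + 2) v = some c := by
  refine (base_fix_iff (G.awake_mono (Nat.le_succ r) hv)).2 ⟨?_, fun u hu => ?_, Or.inl h⟩
  · have : G.neighbors (r + 1) v = G.neighbors r v := by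
      ext u; simp only [mem_neighbors, hadj]
    rw [this]
    exact ((base_fix_iff hv).1 h).1
  · exact base_proper ((hadj u).1 hu) h

/-! ### Extensions of the base coloring -/

/-- Distinct identifiers let a node follow its neighbors: the identifiers remembered in an extension
are those of the neighbors over edges that persist since its start. -/
lemma mem_cons_iff {s a : ℕ} {v : V} (hv : v ∈ G.awake s) (hid : DistinctIds ω (s + a + 1))
    {i : ℕ} : i ∈ (slotAt G ω a (s + a + 1) v).cons ↔
      ∃ u, Persists G s (s + a) v u ∧ idAt G ω (s + a) u = i := by
  induction a generalizing i with
  | zero =>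
    rw [Nat.add_zero, slotAt_zero_succ hv]
    simp only [baseUpdate, Multiset.mem_toFinset, Multiset.mem_map, mem_inbox]
    constructor
    · rintro ⟨x, ⟨u, hu, rfl⟩, rfl⟩
      exact ⟨u, fun l hl => by rwa [show l = s from le_antisymm hl.2 hl.1], rfl⟩
    · rintro ⟨u, hu, rfl⟩
      exact ⟨_, ⟨u, hu s ⟨le_rfl, le_rfl⟩, rfl⟩, rfl⟩
  | succ a ih =>
    have hid' := hid.mono (show s + a + 1 ≤ s + (a + 1) + 1 by omega)
    rw [← Nat.add_assoc, slotAt_succ_succ a (G.awake_mono (by omega) hv)]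
    simp only [extUpdate, heard, Multiset.mem_toFinset, Multiset.mem_map, Multiset.mem_filter,
      mem_inbox]
    constructor
    · rintro ⟨x, ⟨⟨u, hu, rfl⟩, hx⟩, rfl⟩
      obtain ⟨w, hw, he⟩ := (ih hid').1 hx
      have hwa := awake_of_adj_right (hw (s + a) ⟨by omega, le_rfl⟩)
      have : w = u := hid.idAt_inj (r := s + a + 1) (by omega) (G.awake_mono (by omega) hwa)
        (awake_of_adj_right hu) ((idAt_succ hwa).trans he)
      subst this
      exact ⟨w, (persists_succ (by omega)).2 ⟨hw, hu⟩, rfl⟩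
    · rintro ⟨u, hu, rfl⟩
      have hu' := (persists_succ (by omega)).1 hu
      have hua := awake_of_adj_right (hu'.1 (s + a) ⟨by omega, le_rfl⟩)
      exact ⟨_, ⟨⟨u, hu'.2, rfl⟩, (ih hid').2 ⟨u, hu'.1, (idAt_succ hua).symm⟩⟩, rfl⟩

lemma mem_heard_iff {s a : ℕ} {v : V} (hv : v ∈ G.awake s) (hid : DistinctIds ω (s + a + 2))
    {x : Message} :
    x ∈ heard (slotAt G ω a (s + a + 1) v).cons (inbox G ω (s + a + 1) v) ↔
      ∃ u, Persists G s (s + a + 1) v u ∧ messageOf G ω (s + a + 1) u = x := by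
  simp only [heard, Multiset.mem_filter, mem_inbox, mem_cons_iff hv (hid.mono (Nat.le_succ _))]
  constructor
  · rintro ⟨⟨u, hu, rfl⟩, w, hw, he⟩
    have hwa := awake_of_adj_right (hw (s + a) ⟨by omega, le_rfl⟩)
    have : w = u := hid.idAt_inj (r := s + a + 1) (by omega) (G.awake_mono (by omega) hwa)
      (awake_of_adj_right hu) ((idAt_succ hwa).trans he)
    subst this
    exact ⟨w, (persists_succ (by omega)).2 ⟨hw, hu⟩, rfl⟩
  · rintro ⟨u, hu, rfl⟩
    have hu' := (persists_succ (by omega)).1 hu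
    have hua := awake_of_adj_right (hu'.1 (s + a) ⟨by omega, le_rfl⟩)
    exact ⟨⟨u, hu'.2, rfl⟩, u, hu'.1, (idAt_succ hua).symm⟩

lemma taken_heard {s a : ℕ} {v : V} (hv : v ∈ G.awake s) (hid : DistinctIds ω (s + a + 2))
    {c : ℕ} :
    Taken (heard (slotAt G ω a (s + a + 1) v).cons (inbox G ω (s + a + 1) v)) a c ↔
      ∃ u, Persists G s (s + a + 1) v u ∧
        (fixAt G ω a (s + a + 1) u = some c ∨ pickAt G ω a (s + a + 1) u = some c) := by
  constructor
  · rintro ⟨x, hx, h⟩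
    obtain ⟨u, hu, rfl⟩ := (mem_heard_iff hv hid).1 hx
    exact ⟨u, hu, h⟩
  · rintro ⟨u, hu, h⟩
    exact ⟨_, (mem_heard_iff hv hid).2 ⟨u, hu, rfl⟩, h⟩

lemma ext_deg {s : ℕ} (a : ℕ) {v : V} (hv : v ∈ G.awake s) :
    (slotAt G ω a (s + a + 1) v).deg = (G.neighbors s v).card := by
  induction a with
  | zero =>
    rw [Nat.add_zero, slotAt_zero_succ hv]
    exact card_inbox G ω s v
  | succ a ih =>
    rw [← Nat.add_assoc, slotAt_succ_succ a (G.awake_mono (by omega) hv)]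
    exact ih

lemma ext_fix_keep {s a : ℕ} {v : V} (hv : v ∈ G.awake s)
    (h : fixAt G ω a (s + a + 1) v ≠ none) :
    fixAt G ω (a + 1) (s + a + 2) v = fixAt G ω a (s + a + 1) v := by
  rw [fixAt, slotAt_succ_succ a (G.awake_mono (by omega) hv)]
  exact if_neg h

lemma ext_fix_keep_add {s a : ℕ} (i : ℕ) {v : V} (hv : v ∈ G.awake s)
    (h : fixAt G ω a (s + a + 1) v ≠ none) :
    fixAt G ω (a + i) (s + (a + i) + 1) v = fixAt G ω a (s + a + 1) v := by
  induction i with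
  | zero => rfl
  | succ i ih => exact (ext_fix_keep hv (ih ▸ h)).trans ih

lemma ext_fix_iff {s a : ℕ} {v : V} (hv : v ∈ G.awake s) (hid : DistinctIds ω (s + a + 2))
    (h : fixAt G ω a (s + a + 1) v = none) {c : ℕ} :
    fixAt G ω (a + 1) (s + a + 2) v = some c ↔ pickAt G ω a (s + a + 1) v = some c ∧
      ¬ ∃ u, Persists G s (s + a + 1) v u ∧
        (fixAt G ω a (s + a + 1) u = some c ∨ pickAt G ω a (s + a + 1) u = some c) := by
  rw [fixAt, slotAt_succ_succ a (G.awake_mono (by omega) hv)]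
  simp only [extUpdate]
  rw [if_pos h, Option.filter_eq_some_iff]
  simp only [decide_eq_true_eq, taken_heard hv hid]

lemma ext_pal_iff {s a : ℕ} {v : V} (hv : v ∈ G.awake s) (hid : DistinctIds ω (s + a + 2))
    {c : ℕ} : c ∈ palAt G ω (a + 1) (s + a + 2) v ↔
      c ∈ Finset.Icc 1 ((G.neighbors s v).card + 1) ∧ ¬ ∃ u, Persists G s (s + a + 1) v u ∧
        (fixAt G ω a (s + a + 1) u = some c ∨ pickAt G ω a (s + a + 1) u = some c) := by
  rw [palAt, slotAt_succ_succ a (G.awake_mono (by omega) hv)]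
  simp only [extUpdate, mem_freeColors, taken_heard hv hid, ext_deg a hv]

/-- An extension is proper on the edges that persist since its start. -/
lemma ext_proper {s a : ℕ} {u v : V} (hid : DistinctIds ω (s + a + 1))
    (h : Persists G s (s + a) u v) {c : ℕ} (hu : fixAt G ω a (s + a + 1) u = some c) :
    fixAt G ω a (s + a + 1) v ≠ some c := by
  have hadj := h s ⟨le_rfl, by omega⟩
  induction a with
  | zero => exact base_proper hadj hu
  | succ a ih =>
    have hua := awake_of_adj_left hadj
    have hva := awake_of_adj_right hadj
    have hid' := hid.mono (show s + a + 1 ≤ s + (a + 1) + 1 by omega)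
    replace ih := ih hid' (h.mono (by omega))
    intro hv
    change fixAt G ω (a + 1) (s + a + 2) u = some c at hu
    change fixAt G ω (a + 1) (s + a + 2) v = some c at hv
    by_cases hu0 : fixAt G ω a (s + a + 1) u = none
    · obtain ⟨hu1, hu2⟩ := (ext_fix_iff hua hid hu0).1 hu
      by_cases hv0 : fixAt G ω a (s + a + 1) v = none
      · obtain ⟨hv1, -⟩ := (ext_fix_iff hva hid hv0).1 hv
        exact hu2 ⟨v, h, Or.inr hv1⟩
      · exact hu2 ⟨v, h, Or.inl ((ext_fix_keep hva hv0).symm.trans hv)⟩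
    · have hu1 := (ext_fix_keep hua hu0).symm.trans hu
      by_cases hv0 : fixAt G ω a (s + a + 1) v = none
      · exact ((ext_fix_iff hva hid hv0).1 hv).2 ⟨u, h.symm, Or.inl hu1⟩
      · exact ih hu1 ((ext_fix_keep hva hv0).symm.trans hv)

end Execution

/-! ### Static neighborhoods -/

section Static

variable {V : Type} {G : DynGraph V} {r r₂ : ℕ} {v : V}

lemma DynGraph.IsStatic.mono {α r' : ℕ} (h : G.IsStatic α v r r₂) (hr : r' ≤ r₂) :
    G.IsStatic α v r r' :=
  fun l hl l' hl' => h l ⟨hl.1, hl.2.trans hr⟩ l' ⟨hl'.1, hl'.2.trans hr⟩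

lemma DynGraph.mem_neighborhood_of_adj {l : ℕ} {u : V} (h : (G.graph l).Adj v u) :
    u ∈ G.neighborhood l 2 v := by
  have h1 : (G.graph l).edist v u = 1 := SimpleGraph.edist_eq_one_iff_adj.2 h
  change (G.graph l).edist v u ≤ ((2 : ℕ) : ℕ∞)
  rw [h1]
  norm_num

lemma DynGraph.mem_neighborhood_of_adj_adj {l : ℕ} {u w : V} (h : (G.graph l).Adj v u)
    (h' : (G.graph l).Adj u w) : w ∈ G.neighborhood l 2 v := by
  have h1 : (G.graph l).edist v u = 1 := SimpleGraph.edist_eq_one_iff_adj.2 h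
  have h2 : (G.graph l).edist u w = 1 := SimpleGraph.edist_eq_one_iff_adj.2 h'
  change (G.graph l).edist v w ≤ ((2 : ℕ) : ℕ∞)
  refine (SimpleGraph.edist_triangle (v := u)).trans ?_
  rw [h1, h2]
  norm_num

lemma DynGraph.IsStatic.adj_of_adj (h : G.IsStatic 2 v r r₂) {l l' : ℕ} (hl : l ∈ Set.Icc r r₂)
    (hl' : l' ∈ Set.Icc r r₂) {u : V} (hu : (G.graph l).Adj v u) : (G.graph l').Adj v u := by
  have hv : v ∈ G.neighborhood l 2 v := by simp [DynGraph.neighborhood]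
  exact ((h l hl l' hl').2 v hv u (DynGraph.mem_neighborhood_of_adj hu)).1 hu

lemma DynGraph.IsStatic.adj_iff (h : G.IsStatic 2 v r r₂) {l l' : ℕ} (hl : l ∈ Set.Icc r r₂)
    (hl' : l' ∈ Set.Icc r r₂) {u : V} : (G.graph l).Adj v u ↔ (G.graph l').Adj v u :=
  ⟨h.adj_of_adj hl hl', h.adj_of_adj hl' hl⟩

lemma DynGraph.IsStatic.adj_iff_of_adj (h : G.IsStatic 2 v r r₂) {l l' : ℕ}
    (hl : l ∈ Set.Icc r r₂) (hl' : l' ∈ Set.Icc r r₂) {u w : V} (hu : (G.graph l).Adj v u) :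
    (G.graph l).Adj u w ↔ (G.graph l').Adj u w := by
  have hu' := h.adj_of_adj hl hl' hu
  constructor
  · intro hw
    exact ((h l hl l' hl').2 u (DynGraph.mem_neighborhood_of_adj hu) w
      (DynGraph.mem_neighborhood_of_adj_adj hu hw)).1 hw
  · intro hw
    exact ((h l' hl' l hl).2 u (DynGraph.mem_neighborhood_of_adj hu') w
      (DynGraph.mem_neighborhood_of_adj_adj hu' hw)).1 hw

end Static

/-! ### The guarantees from complete colorings -/

section Guarantee

variable {N m j : ℕ} {V : Type} [Fintype V] {G : DynGraph V}
  {ω : (coloringAlgorithm N m j).Tape V}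

/-- The guarantees hold if the identifiers are distinct, every extension is complete at age `j`, and
every node whose surroundings are static for `j` rounds has a base color. -/
lemma guarantees_of_complete {L : ℕ} (hid : DistinctIds ω L)
    (hext : ∀ v s, s + j < L → v ∈ G.awake s → fixAt G ω j (s + j + 1) v ≠ none)
    (hbase : ∀ v r, r + j < L → v ∈ G.awake r → G.IsStatic 2 v r (r + j) →
      fixAt G ω 0 (r + j + 1) v ≠ none) :
    Guarantees (coloringAlgorithm N m j) (j + 1) L G ω := by
  constructor
  · intro r hr
    -- nobody is awake in round `0`, so a window that contains it has no nodes
    have hwin : ∀ v ∈ G.windowNodes (j + 1) r, ∃ s, r = s + j ∧ v ∈ G.awake s := by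
      intro v hv
      by_cases h : r ≤ j
      · have := hv 0 ⟨by omega, by omega⟩
        simp [G.awake_zero] at this
      · exact ⟨r - j, by omega, hv _ ⟨by omega, by omega⟩⟩
    refine ⟨⟨fun v hv => ?_, fun u hu v hv huv => ?_⟩, fun v hv => ?_⟩
    · obtain ⟨s, rfl, hs⟩ := hwin v hv
      exact hext v s hr hs
    · obtain ⟨s, rfl, hs⟩ := hwin u hu
      obtain ⟨c, hc⟩ := Option.ne_none_iff_exists'.1 (hext u s hr hs)
      have hp : Persists G s (s + j) u v := fun l hl => huv.2 l ⟨by have := hl.1; omega, hl.2⟩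
      intro he
      exact ext_proper (hid.mono hr) hp hc (he.symm.trans hc)
    · obtain ⟨s, rfl, hs⟩ := hwin v hv
      obtain ⟨c, hc⟩ := Option.ne_none_iff_exists'.1 (hext v s hr hs)
      obtain ⟨h1, h2⟩ := (slot_range j (s + j + 1) v).2 c hc
      rw [ext_deg j hs] at h2
      refine ⟨c, hc, h1, h2.trans (Nat.add_le_add_right ?_ 1)⟩
      rw [← Set.ncard_coe_finset]
      refine Set.ncard_le_ncard (fun u hu => ?_) (Set.toFinite _)
      exact ⟨s, ⟨by omega, by omega⟩, (mem_neighbors G).1 hu⟩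
  · intro r r₂ hr₂ v hv hst
    by_cases hj : r + j ≤ r₂
    swap
    · intro l hl
      have := hl.1.trans hl.2
      omega
    obtain ⟨c, hc⟩ := Option.ne_none_iff_exists'.1
      (hbase v r (by omega) hv (hst.mono hj))
    have hkeep : ∀ i, r + j + i ≤ r₂ → fixAt G ω 0 (r + j + i + 1) v = some c := by
      intro i
      induction i with
      | zero => exact fun _ => hc
      | succ i ih =>
        intro hi
        have hv' : v ∈ G.awake (r + j + i) := G.awake_mono (by omega) hv
        refine base_keep hv' (fun u => ?_) (ih (by omega))
        exact hst.adj_iff ⟨by omega, by omega⟩ ⟨by omega, by omega⟩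
    have hout : ∀ l ∈ Set.Icc (r + 2 * (j + 1)) r₂,
        (coloringAlgorithm N m j).outputAt G ω l v = some c := by
      intro l hl
      obtain ⟨h1, h2⟩ := hl
      obtain ⟨i, rfl⟩ : ∃ i, l = r + j + i + j := ⟨l - (r + 2 * j), by omega⟩
      have h0 := hkeep i (by omega)
      have := ext_fix_keep_add (a := 0) (s := r + j + i) j (G.awake_mono (by omega) hv)
        (by rw [Nat.add_zero, h0]; simp)
      rw [Nat.zero_add, Nat.add_zero, h0] at this
      exact this
    intro l hl l' hl'
    rw [hout l hl, hout l' hl']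

end Guarantee

/-! ### Progress against an adaptive adversary -/

section Adversarial

variable {N m j : ℕ} {V : Type} (adv : Adversary (coloringAlgorithm N m j) V)

lemma play_congr {t : ℕ} {ω ω' : (coloringAlgorithm N m j).Tape V}
    (h : ∀ s ∈ Set.Iio t, ω s = ω' s) {r : ℕ} (hr : r < t) :
    (adv.play ω).awake r = (adv.play ω').awake r ∧ (adv.play ω).graph r = (adv.play ω').graph r :=
  adv.adapted r ω ω' fun s hs => h s (lt_of_le_of_lt hs hr)

lemma distinctIds_congr {t : ℕ} {ω ω' : (coloringAlgorithm N m j).Tape V}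
    (h : ∀ s ∈ Set.Iio t, ω s = ω' s) : DistinctIds ω t → DistinctIds ω' t := by
  intro hd r hr s hs u v huv
  have := hd r hr s hs u v huv
  rwa [drawnId, drawnId, h r hr, h s hs] at this

lemma isStatic_congr {α t r r₂ : ℕ} {v : V} {ω ω' : (coloringAlgorithm N m j).Tape V}
    (h : ∀ s ∈ Set.Iio t, ω s = ω' s) (hr : r₂ < t) (hs : (adv.play ω).IsStatic α v r r₂) :
    (adv.play ω').IsStatic α v r r₂ := by
  intro l hl l' hl'
  have e1 := (play_congr adv h (hl.2.trans_lt hr)).2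
  have e2 := (play_congr adv h (hl'.2.trans_lt hr)).2
  have := hs l hl l' hl'
  simpa only [DynGraph.neighborhood, e1, e2] using this

variable [Fintype V]

/-- The states at the beginning of round `t` depend only on the coins of the rounds before `t`. -/
lemma stateAt_congr {t : ℕ} {ω ω' : (coloringAlgorithm N m j).Tape V}
    (h : ∀ s ∈ Set.Iio t, ω s = ω' s) :
    (coloringAlgorithm N m j).stateAt (adv.play ω) ω t =
      (coloringAlgorithm N m j).stateAt (adv.play ω') ω' t := by
  induction t with
  | zero => rfl
  | succ t ih =>
    obtain ⟨h1, h2⟩ := play_congr adv h (Nat.lt_succ_self t)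
    funext v
    simp only [DistAlgorithm.stateAt, ih fun s hs => h s (Nat.lt_succ_of_lt hs),
      h t (Nat.lt_succ_self t)]
    rw [h1, h2]

lemma slotAt_congr {t : ℕ} {ω ω' : (coloringAlgorithm N m j).Tape V}
    (h : ∀ s ∈ Set.Iio t, ω s = ω' s) (a : ℕ) (v : V) :
    slotAt (adv.play ω) ω a t v = slotAt (adv.play ω') ω' a t v := by
  rw [slotAt, slotAt, stateAt_congr adv h]

open Classical in
/-- A node that fails to get a color in two consecutive rounds was unlucky: whatever the past, this
has probability at most `15/16`, although the edges of the two rounds depend on their coins. -/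
lemma measureReal_failsTwice_le {a b t : ℕ} {v : V}
    {H E : Set ((coloringAlgorithm N m j).Tape V)}
    (hH : DependsOn (fun ω => ω ∈ H) (Set.Iio t))
    {C : (coloringAlgorithm N m j).Tape V → Finset V} (hC : DependsOn C (Set.Iio t))
    (hE : ∀ ω ∈ E, ω ∈ H ∧ ∃ N₁ N₂ D, D + 1 ≤ m ∧
      FailsTwice (drawColor (N := N) (m := m)) (fixAt (adv.play ω) ω a t)
        (fixAt (adv.play ω) ω b (t + 1)) (palAt (adv.play ω) ω a t)
        (palAt (adv.play ω) ω b (t + 1)) (ω t) (ω (t + 1)) v (C ω) N₁ N₂ D) :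
    ((coloringAlgorithm N m j).tapeMeasure V).real E ≤
      15 / 16 * ((coloringAlgorithm N m j).tapeMeasure V).real H := by
  have hsamp := isColorSampler N m j
  let F : (coloringAlgorithm N m j).Tape V → Finset V := fun ω =>
    (C ω).filter fun u => fixAt (adv.play ω) ω b (t + 1) u = none
  let pal : (coloringAlgorithm N m j).Tape V → V → Finset ℕ := fun ω =>
    palAt (adv.play ω) ω b (t + 1)
  have hsucc : ∀ {ω ω' : (coloringAlgorithm N m j).Tape V},
      (∀ s ∈ Set.Iio (t + 1), ω s = ω' s) → ∀ s ∈ Set.Iio t, ω s = ω' s :=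
    fun h s hs => h s (Nat.lt_succ_of_lt hs)
  refine measureReal_two_rounds_le _ hH
    (B₁ := fun ω => crowded (activeCoins N m)
      ((C ω).filter fun u => fixAt (adv.play ω) ω a t u = none))
    (B₂ := fun ω => {y | v ∉ F ω ∧ (pal ω v).Nonempty ∧ (pal ω v).card ≤ m ∧
      (F ω).card ≤ 2 * (pal ω v).card ∧ y ∈ collision drawColor (F ω) (pal ω) v})
    ?_ ?_ ?_ ?_ ?_
  · intro ω ω' h
    simp only [hC h, fixAt, slotAt_congr adv h]
  · intro ω ω' h
    have e1 : pal ω = pal ω' := funext fun u => congrArg Slot.pal (slotAt_congr adv h b u)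
    have e2 : F ω = F ω' := by simp only [F, hC (hsucc h), fixAt, slotAt_congr adv h]
    simp only [e1, e2]
  · exact fun ω _ => measureReal_crowded_le hsamp _
  · intro ω _
    by_cases h : v ∉ F ω ∧ (pal ω v).Nonempty ∧ (pal ω v).card ≤ m ∧
      (F ω).card ≤ 2 * (pal ω v).card
    · obtain ⟨h1, h2, h3, h4⟩ := h
      exact (measureReal_mono fun y hy => hy.2.2.2.2).trans
        (measureReal_collision_le hsamp h1 h2 h3 h4)
    · rw [Set.eq_empty_of_forall_notMem (s := {y | v ∉ F ω ∧ _}) fun y hy =>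
        h ⟨hy.1, hy.2.1, hy.2.2.1, hy.2.2.2.1⟩]
      simp only [measureReal_empty]
      norm_num
  · intro ω hω
    obtain ⟨h, N₁, N₂, D, hD, hf⟩ := hE ω hω
    refine ⟨h, ?_⟩
    rcases hf.crowded_or_collision hsamp.act_of_draw mem_of_drawColor with h' | h'
    · exact Or.inl h'
    · exact Or.inr ⟨h'.1, h'.2.1, h'.2.2.1.trans hD, h'.2.2.2⟩

/-- The node `v` is awake in round `s` and uncolored at age `a` of the extension that is started then,
although the identifiers drawn up to then are distinct. -/
def extUncolored (s : ℕ) (v : V) (a : ℕ) : Set ((coloringAlgorithm N m j).Tape V) :=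
  {ω | v ∈ (adv.play ω).awake s ∧ DistinctIds ω (s + a + 1) ∧
    fixAt (adv.play ω) ω a (s + a + 1) v = none}

lemma card_neighbors_lt (G : DynGraph V) (r : ℕ) (v : V) :
    (G.neighbors r v).card < Fintype.card V := by
  classical
  refine Finset.card_lt_univ_of_notMem (x := v) ?_
  simp [mem_neighbors]

lemma measureReal_extUncolored_add_two (hm : Fintype.card V ≤ m) (s : ℕ) (v : V) (a : ℕ) :
    ((coloringAlgorithm N m j).tapeMeasure V).real (extUncolored adv s v (a + 2)) ≤
      15 / 16 * ((coloringAlgorithm N m j).tapeMeasure V).real (extUncolored adv s v a) := by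
  classical
  refine measureReal_failsTwice_le adv (a := a) (b := a + 1) (t := s + a + 1) (v := v) ?_
    (C := fun ω => Finset.univ.filter fun u => Persists (adv.play ω) s (s + a) v u) ?_ ?_
  · intro ω ω' h
    have e1 := (play_congr adv h (show s < s + a + 1 by omega)).1
    have e2 : DistinctIds ω (s + a + 1) = DistinctIds ω' (s + a + 1) :=
      propext ⟨distinctIds_congr h, distinctIds_congr fun s hs => (h s hs).symm⟩
    simp only [extUncolored, Set.mem_ofPred_eq, e1, e2, fixAt, slotAt_congr adv h]
  · intro ω ω' h
    refine Finset.filter_congr fun u _ => ?_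
    refine forall₂_congr fun l hl => ?_
    rw [(play_congr adv h (show l < s + a + 1 from Nat.lt_succ_of_le hl.2)).2]
  · rintro ω ⟨hv, hid, hnone⟩
    set G := adv.play ω
    have hid2 : DistinctIds ω (s + a + 2) := hid.mono (by omega)
    have hmid : fixAt G ω (a + 1) (s + a + 2) v = none := by
      by_contra h
      exact h ((ext_fix_keep (a := a + 1) hv h).symm.trans hnone)
    have hstart : fixAt G ω a (s + a + 1) v = none := by
      by_contra h
      exact h ((ext_fix_keep hv h).symm.trans hmid)
    refine ⟨⟨hv, hid.mono (by omega), hstart⟩,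
      Finset.univ.filter fun u => Persists G s (s + a + 1) v u,
      Finset.univ.filter fun u => Persists G s (s + a + 2) v u, (G.neighbors s v).card,
      (card_neighbors_lt G s v).trans_le hm, ?_⟩
    have hawake : ∀ u ∈ Finset.univ.filter fun u => Persists G s (s + a) v u, u ∈ G.awake s :=
      fun u hu => awake_of_adj_right ((Finset.mem_filter.1 hu).2 s ⟨le_rfl, by omega⟩)
    constructor
    · intro h
      exact ((Finset.mem_filter.1 h).2 s ⟨le_rfl, by omega⟩).ne rfl
    · exact Finset.monotone_filter_right _ fun u _ h => h.mono (by omega)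
    · exact Finset.monotone_filter_right _ fun u _ h => h.mono (by omega)
    · exact Finset.card_le_card fun u hu =>
        (mem_neighbors G).2 ((Finset.mem_filter.1 hu).2 s ⟨le_rfl, by omega⟩)
    · exact fun u hu h => ext_fix_keep (hawake u hu) h
    · exact fun u hu h c hc => ((ext_fix_iff (hawake u hu) hid2 h).1 hc).1
    · intro c
      rw [show s + a + 1 + 1 = s + a + 2 from rfl, ext_pal_iff hv hid2]
      simp
    · exact hmid
    · intro c hc
      by_contra hcon
      have : fixAt G ω (a + 2) (s + (a + 1) + 2) v = some c := by
        refine (ext_fix_iff (a := a + 1) hv hid hmid).2 ⟨proposal_eq_some.2 ⟨hmid, hc⟩, ?_⟩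
        rintro ⟨u, hu, hu'⟩
        exact hcon ⟨u, Finset.mem_filter.2 ⟨Finset.mem_univ _, hu⟩, hu'⟩
      rw [show s + (a + 1) + 2 = s + (a + 2) + 1 by omega, hnone] at this
      exact absurd this (by simp)

/-- The node `v` is awake in round `r` and has no base color after `i + 1` rounds in which its
`2`-neighborhood is static. -/
def baseUncolored (r : ℕ) (v : V) (i : ℕ) : Set ((coloringAlgorithm N m j).Tape V) :=
  {ω | v ∈ (adv.play ω).awake r ∧ (adv.play ω).IsStatic 2 v r (r + i) ∧
    fixAt (adv.play ω) ω 0 (r + i + 1) v = none}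

lemma measureReal_baseUncolored_add_two (hm : Fintype.card V ≤ m) (r : ℕ) (v : V) (i : ℕ) :
    ((coloringAlgorithm N m j).tapeMeasure V).real (baseUncolored adv r v (i + 2)) ≤
      15 / 16 * ((coloringAlgorithm N m j).tapeMeasure V).real (baseUncolored adv r v i) := by
  classical
  refine measureReal_failsTwice_le adv (a := 0) (b := 0) (t := r + i + 1) (v := v) ?_
    (C := fun ω => (adv.play ω).neighbors (r + i) v) ?_ ?_
  · intro ω ω' h
    have e1 := (play_congr adv h (show r < r + i + 1 by omega)).1
    have e2 : (adv.play ω).IsStatic 2 v r (r + i) = (adv.play ω').IsStatic 2 v r (r + i) :=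
      propext ⟨isStatic_congr adv h (Nat.lt_succ_self _),
        isStatic_congr adv (fun s hs => (h s hs).symm) (Nat.lt_succ_self _)⟩
    simp only [baseUncolored, Set.mem_ofPred_eq, e1, e2, fixAt, slotAt_congr adv h]
  · intro ω ω' h
    ext u
    simp only [mem_neighbors, (play_congr adv h (Nat.lt_succ_self (r + i))).2]
  · rintro ω ⟨hv, hst, hnone⟩
    set G := adv.play ω
    have hv' : ∀ l, r ≤ l → v ∈ G.awake l := fun l hl => G.awake_mono hl hv
    have hmem : ∀ i' ≤ i + 2, r + i' ∈ Set.Icc r (r + (i + 2)) :=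
      fun i' hi' => ⟨by omega, by omega⟩
    have h0 := hmem i (by omega)
    have h1 := hmem (i + 1) (by omega)
    have h2 := hmem (i + 2) le_rfl
    have hmid : fixAt G ω 0 (r + i + 2) v = none := by
      by_contra h
      obtain ⟨c, hc⟩ := Option.ne_none_iff_exists'.1 h
      have := base_keep (hv' (r + i + 1) (by omega)) (fun u => hst.adj_iff h2 h1) hc
      exact absurd (hnone.symm.trans this) (by simp)
    have hstart : fixAt G ω 0 (r + i + 1) v = none := by
      by_contra h
      obtain ⟨c, hc⟩ := Option.ne_none_iff_exists'.1 h
      have := base_keep (hv' (r + i) (by omega)) (fun u => hst.adj_iff h1 h0) hc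
      exact absurd (hmid.symm.trans this) (by simp)
    have hN1 : G.neighbors (r + i + 1) v = G.neighbors (r + i) v := by
      ext u; rw [mem_neighbors, mem_neighbors]; exact hst.adj_iff h1 h0
    have hN2 : G.neighbors (r + i + 2) v = G.neighbors (r + i) v := by
      ext u; rw [mem_neighbors, mem_neighbors]; exact hst.adj_iff h2 h0
    have hpal : ∀ c, c ∈ palAt G ω 0 (r + i + 2) v ↔
        c ∈ Finset.Icc 1 ((G.neighbors (r + i) v).card + 1) ∧
        ¬ ∃ u ∈ G.neighbors (r + i) v, fixAt G ω 0 (r + i + 1) u = some c ∨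
          pickAt G ω 0 (r + i + 1) u = some c := by
      intro c
      rw [show r + i + 2 = r + i + 1 + 1 from rfl, base_pal_iff (hv' _ (by omega)), hN1, ← hN1]
      simp only [mem_neighbors]
    refine ⟨⟨hv, hst.mono (by omega), hstart⟩, G.neighbors (r + i) v, G.neighbors (r + i) v,
      (G.neighbors (r + i) v).card, (card_neighbors_lt G _ v).trans_le hm, ?_⟩
    constructor
    · simp [mem_neighbors]
    · exact subset_rfl
    · exact subset_rfl
    · exact le_rfl
    · intro u hu h
      rw [mem_neighbors] at hu
      obtain ⟨c, hc⟩ := Option.ne_none_iff_exists'.1 h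
      rw [hc]
      exact base_keep (awake_of_adj_right hu) (fun w => (hst.adj_iff_of_adj h0 h1 hu).symm) hc
    · intro u hu h c hc
      rw [mem_neighbors] at hu
      have hua := G.awake_mono (Nat.le_succ _) (awake_of_adj_right hu)
      exact (((base_fix_iff hua).1 hc).2.2.resolve_left (by rw [h]; simp)).1
    · exact hpal
    · exact hmid
    · intro c hc
      by_contra hcon
      have hle := (Finset.mem_Icc.1 ((hpal c).1 (mem_of_drawColor hc)).1).2
      have : fixAt G ω 0 (r + i + 2 + 1) v = some c := by
        refine (base_fix_iff (hv' _ (by omega))).2 ⟨by rwa [hN2], fun u hu hc' => ?_,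
          Or.inr ⟨proposal_eq_some.2 ⟨hmid, hc⟩, fun u hu hc' => ?_⟩⟩
        · exact hcon ⟨u, by rwa [← hN2, mem_neighbors], Or.inl hc'⟩
        · exact hcon ⟨u, by rwa [← hN2, mem_neighbors], Or.inr hc'⟩
      rw [show r + i + 2 + 1 = r + (i + 2) + 1 by omega, hnone] at this
      exact absurd this (by simp)

instance : IsProbabilityMeasure ((coloringAlgorithm N m j).tapeMeasure V) := by
  unfold DistAlgorithm.tapeMeasure
  infer_instance

lemma le_pow_of_add_two_le {f : ℕ → ℝ} (h0 : f 0 ≤ 1) (h : ∀ i, f (i + 2) ≤ 15 / 16 * f i)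
    (i : ℕ) : f (2 * i) ≤ (15 / 16) ^ i := by
  induction i with
  | zero => simpa using h0
  | succ i ih =>
    calc f (2 * (i + 1)) ≤ 15 / 16 * f (2 * i) := h (2 * i)
      _ ≤ 15 / 16 * (15 / 16) ^ i := by linarith
      _ = (15 / 16) ^ (i + 1) := by ring

lemma measureReal_extUncolored_le (hm : Fintype.card V ≤ m) (s : ℕ) (v : V) (i : ℕ) :
    ((coloringAlgorithm N m j).tapeMeasure V).real (extUncolored adv s v (2 * i)) ≤
      (15 / 16) ^ i :=
  le_pow_of_add_two_le
    (f := fun a => ((coloringAlgorithm N m j).tapeMeasure V).real (extUncolored adv s v a))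
    measureReal_le_one (measureReal_extUncolored_add_two adv hm s v) i

lemma measureReal_baseUncolored_le (hm : Fintype.card V ≤ m) (r : ℕ) (v : V) (i : ℕ) :
    ((coloringAlgorithm N m j).tapeMeasure V).real (baseUncolored adv r v (2 * i)) ≤
      (15 / 16) ^ i :=
  le_pow_of_add_two_le
    (f := fun a => ((coloringAlgorithm N m j).tapeMeasure V).real (baseUncolored adv r v a))
    measureReal_le_one (measureReal_baseUncolored_add_two adv hm r v) i

end Adversarial

/-! ### Distinct identifiers and the union bound -/

section Identifiers

variable {N m j : ℕ} {V : Type} [Fintype V]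

lemma measureReal_id_eq (i : Fin (N + 1)) :
    (PMF.uniformOfFintype (coloringAlgorithm N m j).Coin).toMeasure.real
      ({x | x.1 = i} : Set (Coin N m)) = 1 / (N + 1) := by
  have h1 : ({x | x.1 = i} : Set (Coin N m)) =
      (({i} ×ˢ Finset.univ : Finset (Coin N m)) : Set (Coin N m)) := by
    ext x
    simp only [Set.mem_ofPred_eq, Finset.mem_coe, Finset.mem_product, Finset.mem_univ, and_true,
      Finset.mem_singleton]
  have h2 : Fintype.card (coloringAlgorithm N m j).Coin = (N + 1) * (4 * m.factorial) := by
    change Fintype.card (Coin N m) = _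
    simp
  have h3 : ({i} ×ˢ Finset.univ : Finset (Coin N m)).card = 4 * m.factorial := by
    rw [Finset.card_product]
    simp
  have h4 : (m.factorial : ℝ) ≠ 0 := by exact_mod_cast m.factorial_ne_zero
  have h5 : (N + 1 : ℝ) ≠ 0 := by positivity
  rw [h1]
  refine (uniform_real_eq_card_div (Ω := (coloringAlgorithm N m j).Coin) _).trans ?_
  refine (congrArg₂ (fun a b : ℕ => (a : ℝ) / b) h3 h2).trans ?_
  push_cast
  field_simp

lemma measureReal_drawnId_eq_of_lt {r s : ℕ} (hsr : s < r) (u v : V) :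
    ((coloringAlgorithm N m j).tapeMeasure V).real {ω | drawnId ω r u = drawnId ω s v} ≤
      1 / (N + 1) := by
  have h := measureReal_fresh_le (Y := V → (coloringAlgorithm N m j).Coin)
    (Measure.pi fun _ => (PMF.uniformOfFintype (coloringAlgorithm N m j).Coin).toMeasure)
    (t := r) (H := Set.univ) (fun _ _ _ => rfl)
    (B := fun ω => {y | y u ∈ ({x | x.1 = drawnId ω s v} : Set (Coin N m))})
    (fun ω ω' h => by simp only [drawnId, h s hsr]) (q := 1 / (N + 1))
    (fun ω _ => ((measureReal_pi_eval u _).trans (measureReal_id_eq _)).le)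
  rw [probReal_univ, mul_one] at h
  exact le_trans (measureReal_mono fun ω hω => Set.mem_sep trivial hω) h

lemma measureReal_drawnId_eq_same (r : ℕ) {u v : V} (huv : u ≠ v) :
    ((coloringAlgorithm N m j).tapeMeasure V).real {ω | drawnId ω r u = drawnId ω r v} ≤
      1 / (N + 1) := by
  set μ : Measure (V → (coloringAlgorithm N m j).Coin) :=
    Measure.pi fun _ => (PMF.uniformOfFintype (coloringAlgorithm N m j).Coin).toMeasure
  let S : Fin (N + 1) → Set (coloringAlgorithm N m j).Coin := fun i =>
    ({x | x.1 = i} : Set (Coin N m))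
  have hμ : μ.real (⋃ i ∈ (Finset.univ : Finset (Fin (N + 1))), {y | y u ∈ S i ∧ y v ∈ S i}) ≤
      1 / (N + 1) := by
    refine (measureReal_biUnion_finset_le _ _).trans ?_
    rw [Finset.sum_congr rfl fun i _ => (measureReal_pi_eval₂ huv (S i) (S i)).trans
      (congrArg₂ (· * ·) (measureReal_id_eq i) (measureReal_id_eq i))]
    rw [Finset.sum_const, Finset.card_univ, Fintype.card_fin, nsmul_eq_mul]
    push_cast
    have h5 : (N + 1 : ℝ) ≠ 0 := by positivity
    field_simp
    exact le_rfl
  have h := measureReal_fresh_le (Y := V → (coloringAlgorithm N m j).Coin) μ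
    (t := r) (H := Set.univ) (fun _ _ _ => rfl)
    (B := fun _ => ⋃ i ∈ (Finset.univ : Finset (Fin (N + 1))), {y | y u ∈ S i ∧ y v ∈ S i})
    (fun _ _ _ => rfl) (fun _ _ => hμ)
  rw [probReal_univ, mul_one] at h
  refine le_trans (measureReal_mono fun ω hω => ?_) h
  refine ⟨trivial, ?_⟩
  simp only [Set.mem_iUnion]
  exact ⟨drawnId ω r v, Finset.mem_univ _, hω, rfl⟩

lemma measureReal_drawnId_eq (r s : ℕ) {u v : V} (huv : u ≠ v) :
    ((coloringAlgorithm N m j).tapeMeasure V).real {ω | drawnId ω r u = drawnId ω s v} ≤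
      1 / (N + 1) := by
  rcases lt_trichotomy s r with h | rfl | h
  · exact measureReal_drawnId_eq_of_lt h u v
  · exact measureReal_drawnId_eq_same s huv
  · simpa only [eq_comm] using measureReal_drawnId_eq_of_lt h v u

lemma measureReal_not_distinctIds_le (L : ℕ) :
    ((coloringAlgorithm N m j).tapeMeasure V).real {ω | ¬ DistinctIds ω L} ≤
      (L * Fintype.card V) ^ 2 / (N + 1) := by
  classical
  let I : Finset ((ℕ × V) × (ℕ × V)) :=
    ((Finset.range L ×ˢ Finset.univ) ×ˢ (Finset.range L ×ˢ Finset.univ)).filter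
      fun p => p.1.2 ≠ p.2.2
  have hsub : {ω : (coloringAlgorithm N m j).Tape V | ¬ DistinctIds ω L} ⊆
      ⋃ p ∈ I, {ω | drawnId ω p.1.1 p.1.2 = drawnId ω p.2.1 p.2.2} := by
    intro ω hω
    simp only [DistinctIds, Set.mem_ofPred_eq] at hω
    push Not at hω
    obtain ⟨r, hr, s, hs, u, v, huv, he⟩ := hω
    simp only [Set.mem_iUnion]
    exact ⟨((r, u), (s, v)), by simp [I, hr, hs, huv], he⟩
  have hI : I.card ≤ (L * Fintype.card V) ^ 2 := by
    refine (Finset.card_filter_le _ _).trans ?_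
    simp only [Finset.card_product, Finset.card_range, Finset.card_univ]
    rw [sq]
  calc _ ≤ _ := measureReal_mono hsub (measure_ne_top _ _)
    _ ≤ ∑ p ∈ I, ((coloringAlgorithm N m j).tapeMeasure V).real
          {ω | drawnId ω p.1.1 p.1.2 = drawnId ω p.2.1 p.2.2} := measureReal_biUnion_finset_le _ _
    _ ≤ ∑ p ∈ I, 1 / (N + 1 : ℝ) := Finset.sum_le_sum fun p hp =>
        measureReal_drawnId_eq _ _ (Finset.mem_filter.1 hp).2
    _ = I.card / (N + 1 : ℝ) := by rw [Finset.sum_const, nsmul_eq_mul, mul_one_div]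
    _ ≤ _ := by
        gcongr
        exact_mod_cast hI

/-- The union bound over all identifiers, all extensions and all starts of static intervals. -/
lemma measureReal_not_guarantees_le {i : ℕ} (hm : Fintype.card V ≤ m)
    (adv : Adversary (coloringAlgorithm N m (2 * i)) V) (L : ℕ) :
    ((coloringAlgorithm N m (2 * i)).tapeMeasure V).real
      {ω | ¬ Guarantees (coloringAlgorithm N m (2 * i)) (2 * i + 1) L (adv.play ω) ω} ≤
      (L * Fintype.card V) ^ 2 / (N + 1) + 2 * (L * Fintype.card V) * (15 / 16) ^ i := by
  classical
  set P := (coloringAlgorithm N m (2 * i)).tapeMeasure V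
  let I : Finset (ℕ × V) := Finset.range L ×ˢ Finset.univ
  have hI : (I.card : ℝ) = L * Fintype.card V := by simp [I]
  have hsub : {ω | ¬ Guarantees (coloringAlgorithm N m (2 * i)) (2 * i + 1) L (adv.play ω) ω} ⊆
      {ω | ¬ DistinctIds ω L} ∪ ((⋃ p ∈ I, extUncolored adv p.1 p.2 (2 * i)) ∪
        ⋃ p ∈ I, baseUncolored adv p.1 p.2 (2 * i)) := by
    intro ω hω
    by_contra hcon
    simp only [Set.mem_union, Set.mem_iUnion, not_or, not_exists, Set.mem_ofPred_eq,
      not_not] at hcon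
    obtain ⟨hid, hext, hbase⟩ := hcon
    refine hω (guarantees_of_complete hid (fun v s hs hv h => ?_) fun v r hr hv hst h => ?_)
    · exact hext (s, v) (Finset.mk_mem_product (Finset.mem_range.2 (by omega)) (Finset.mem_univ _))
         ⟨hv, hid.mono hs, h⟩
    · exact hbase (r, v) (Finset.mk_mem_product (Finset.mem_range.2 (by omega)) (Finset.mem_univ _))
         ⟨hv, hst, h⟩
  have hE : P.real (⋃ p ∈ I, extUncolored adv p.1 p.2 (2 * i)) ≤
      L * Fintype.card V * (15 / 16) ^ i := by
    refine (measureReal_biUnion_finset_le _ _).trans ?_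
    refine (Finset.sum_le_sum fun p _ => measureReal_extUncolored_le adv hm p.1 p.2 i).trans ?_
    rw [Finset.sum_const, nsmul_eq_mul, hI]
  have hB : P.real (⋃ p ∈ I, baseUncolored adv p.1 p.2 (2 * i)) ≤
      L * Fintype.card V * (15 / 16) ^ i := by
    refine (measureReal_biUnion_finset_le _ _).trans ?_
    refine (Finset.sum_le_sum fun p _ => measureReal_baseUncolored_le adv hm p.1 p.2 i).trans ?_
    rw [Finset.sum_const, nsmul_eq_mul, hI]
  have h1 := (measureReal_mono (μ := P) hsub).trans (measureReal_union_le _ _)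
  have h2 := measureReal_union_le (μ := P) (⋃ p ∈ I, extUncolored adv p.1 p.2 (2 * i))
    (⋃ p ∈ I, baseUncolored adv p.1 p.2 (2 * i))
  have h3 : P.real {ω | ¬ DistinctIds ω L} ≤ _ := measureReal_not_distinctIds_le L
  linarith

end Identifiers

/-! ### The choice of the parameters -/

/-- Eleven blocks of two rounds halve the probability of remaining uncolored, so this number of
blocks makes it at most `1 / n ^ e`. -/
def blockCount (e n : ℕ) : ℕ := 11 * (e * (Nat.log 2 n + 1))

lemma pow_blockCount_le (e : ℕ) {n : ℕ} (hn : 0 < n) :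
    (15 / 16 : ℝ) ^ blockCount e n ≤ 1 / (n : ℝ) ^ e := by
  have hn' : (0 : ℝ) < n := by exact_mod_cast hn
  have h1 : (15 / 16 : ℝ) ^ 11 ≤ 1 / 2 := by norm_num
  have h2 : (n : ℝ) ≤ 2 ^ (Nat.log 2 n + 1) := by
    exact_mod_cast (Nat.lt_pow_succ_log_self one_lt_two n).le
  calc (15 / 16 : ℝ) ^ blockCount e n = ((15 / 16 : ℝ) ^ 11) ^ (e * (Nat.log 2 n + 1)) := by
        rw [blockCount, pow_mul]
    _ ≤ (1 / 2) ^ (e * (Nat.log 2 n + 1)) := pow_le_pow_left₀ (by positivity) h1 _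
    _ = 1 / (2 ^ (Nat.log 2 n + 1)) ^ e := by rw [one_div_pow, ← pow_mul, mul_comm e]
    _ ≤ 1 / (n : ℝ) ^ e := by gcongr

lemma isBigO_blockCount (e : ℕ) :
    (fun n => ((2 * blockCount e n + 1 : ℕ) : ℝ)) =O[Filter.atTop] fun n : ℕ => Real.log n := by
  refine Asymptotics.IsBigO.of_bound (22 * e * (1 / Real.log 2 + 1) + 1) ?_
  filter_upwards [Filter.eventually_ge_atTop 3] with n hn
  have hn' : (3 : ℝ) ≤ n := by exact_mod_cast hn
  have h1 : 1 ≤ Real.log n := by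
    rw [Real.le_log_iff_exp_le (by linarith)]
    exact (Real.exp_one_lt_d9.le.trans (by norm_num)).trans hn'
  have h2 : (Nat.log 2 n : ℝ) ≤ Real.log n / Real.log 2 := by
    have := Real.natLog_le_logb n 2
    simpa [Real.logb] using this
  have h3 : 0 < Real.log 2 := Real.log_pos one_lt_two
  rw [Real.norm_of_nonneg (by positivity), Real.norm_of_nonneg (by linarith)]
  simp only [blockCount]
  push_cast
  have h4 : (e : ℝ) * (Nat.log 2 n + 1) ≤ e * (Real.log n / Real.log 2 + Real.log n) := by
    gcongr
  have h5 : (22 * e * (1 / Real.log 2 + 1) + 1) * Real.log n =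
      22 * (e * (Real.log n / Real.log 2 + Real.log n)) + Real.log n := by ring
  rw [h5]
  linarith

theorem corollary2 (c k : ℕ) :
    ∃ (T : ℕ → ℕ) (A : ℕ → DistAlgorithm),
      (fun n => (T n : ℝ)) =O[Filter.atTop] (fun n : ℕ => Real.log n) ∧
      ∀ n : ℕ, 1 ≤ T n ∧
        ∀ adv : Adversary (A n) (Fin n),
          1 - 1 / (n : ℝ) ^ c ≤
            ((A n).tapeMeasure (Fin n)).real
              {ω | Guarantees (A n) (T n) (n ^ k) (adv.play ω) ω} := by
  refine ⟨fun n => 2 * blockCount (k + c + 3) n + 1,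
    fun n => coloringAlgorithm (n ^ (2 * k + c + 4)) n (2 * blockCount (k + c + 3) n),
    isBigO_blockCount _, fun n => ⟨Nat.le_add_left 1 _, fun adv => ?_⟩⟩
  set i := blockCount (k + c + 3) n with hi
  set P := (coloringAlgorithm (n ^ (2 * k + c + 4)) n (2 * i)).tapeMeasure (Fin n)
  set S := {ω | Guarantees (coloringAlgorithm (n ^ (2 * k + c + 4)) n (2 * i)) (2 * i + 1) (n ^ k)
    (adv.play ω) ω}
  have hbad : P.real Sᶜ ≤ _ := measureReal_not_guarantees_le (by simp) adv (n ^ k)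
  have htot : 1 ≤ P.real S + P.real Sᶜ := by
    have := measureReal_union_le (μ := P) S Sᶜ
    rwa [Set.union_compl_self, probReal_univ] at this
  rw [Fintype.card_fin] at hbad
  push_cast at hbad
  suffices h : P.real Sᶜ ≤ 1 / (n : ℝ) ^ c by linarith
  rcases lt_or_ge n 2 with hn | hn
  · interval_cases n
    · -- the degenerate network without nodes, where `1 / 0 ^ c = 0` for `c ≠ 0`
      have h0 : P.real Sᶜ ≤ 0 := by simpa using hbad
      exact h0.trans (by positivity)
    · simp
  have hn' : (2 : ℝ) ≤ n := by exact_mod_cast hn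
  have hpos : (0 : ℝ) < n := by linarith
  have hpow := pow_blockCount_le (k + c + 3) (n := n) (by omega)
  rw [← hi] at hpow
  have t1 : ((n : ℝ) ^ k * n) ^ 2 / ((n : ℝ) ^ (2 * k + c + 4) + 1) ≤ 1 / (n : ℝ) ^ (c + 2) := by
    rw [div_le_div_iff₀ (by positivity) (by positivity)]
    have : ((n : ℝ) ^ k * n) ^ 2 * (n : ℝ) ^ (c + 2) = (n : ℝ) ^ (2 * k + c + 4) := by ring
    linarith
  have t2 : 2 * ((n : ℝ) ^ k * n) * (15 / 16) ^ i ≤ 2 * (1 / (n : ℝ) ^ (c + 2)) := by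
    calc 2 * ((n : ℝ) ^ k * n) * (15 / 16) ^ i
        ≤ 2 * ((n : ℝ) ^ k * n) * (1 / (n : ℝ) ^ (k + c + 3)) := by gcongr
      _ = 2 * (1 / (n : ℝ) ^ (c + 2)) := by
          have : (n : ℝ) ^ (k + c + 3) = (n : ℝ) ^ k * n * (n : ℝ) ^ (c + 2) := by ring
          rw [this]
          field_simp
  have t3 : 3 * (1 / (n : ℝ) ^ (c + 2)) ≤ 1 / (n : ℝ) ^ c := by
    rw [pow_add, mul_one_div, div_le_div_iff₀ (by positivity) (by positivity)]
    have h4 : (3 : ℝ) ≤ (n : ℝ) ^ 2 := by nlinarith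
    have h5 : (0 : ℝ) < (n : ℝ) ^ c := by positivity
    nlinarith
  linarith

end
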